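/- All graphs are finite and simple; $\alpha(G)$ is the independence number and $e(G)$ the number of edges of $G$. Let $\mathbf{Q}(t,n)$ (the inverse Ramsey number) be the minimum of $\alpha(G)$ over all $K_t$-free graphs $G$ on $n$ vertices. For a graph $H$ and a function $f:\mathbb{N}\to\mathbb{R}$ let $\mathbf{RT}(n,H,f(n))$ be the maximum of $e(G)$ over all $n$-vertex $H$-free graphs $G$ with $\alpha(G)\le f(n)$ (and $0$ if there is no such $G$), let \[ \overline{\rho\tau}(H,f)=\limsup_{n\to\infty}\frac{\mathbf{RT}(n,H,f(n))}{n^2}, \] and let $\rho\tau(H,o(f))=\lim_{\delta\to 0^+}\overline{\rho\tau}(H,\delta f)$. Theorem. With $f(n)=\mathbf{Q}(5,n)$, the limit $\rho\tau(K_{13},o(\mathbf{Q}(5,n)))=\lim_{\delta\to0^+}\overline{\rho\tau}(K_{13},\delta\,\mathbf{Q}(5,n))$ exists and \[ \rho\tau(K_{13},o(\mathbf{Q}(5,n)))\le \frac{4}{15}. \] -/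

import Mathlib

open Filter Topology

namespace RamseyTuran

/-- The inverse Ramsey number `Q(t, n)`: the minimum independence number of a `K_t`-free graph
on `n` vertices. -/
noncomputable def inverseRamsey (t n : ℕ) : ℕ :=
  sInf {a : ℕ | ∃ G : SimpleGraph (Fin n), G.CliqueFree t ∧ G.indepNum = a}

/-- For `2 ≤ t` the minimum in the definition of `Q(t, n)` is attained. -/
theorem exists_indepNum_eq_inverseRamsey {t : ℕ} (ht : 2 ≤ t) (n : ℕ) :
    ∃ G : SimpleGraph (Fin n), G.CliqueFree t ∧ G.indepNum = inverseRamsey t n :=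
  Nat.sInf_mem (s := {a : ℕ | ∃ G : SimpleGraph (Fin n), G.CliqueFree t ∧ G.indepNum = a})
    ⟨_, ⊥, SimpleGraph.cliqueFree_bot ht, rfl⟩

/-- The edge counts of the `n`-vertex `H`-free graphs with independence number at most `x`. -/
def edgeCounts {W : Type*} (H : SimpleGraph W) (n : ℕ) (x : ℝ) : Set ℕ :=
  {e : ℕ | ∃ G : SimpleGraph (Fin n), H.Free G ∧ (G.indepNum : ℝ) ≤ x ∧ G.edgeSet.ncard = e}

theorem le_sq_of_mem_edgeCounts {W : Type*} {H : SimpleGraph W} {n : ℕ} {x : ℝ} {e : ℕ}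
    (he : e ∈ edgeCounts H n x) : e ≤ n ^ 2 := by
  classical
  obtain ⟨G, -, -, rfl⟩ := he
  rw [← SimpleGraph.coe_edgeFinset, Set.ncard_coe_finset]
  have h := G.card_edgeFinset_le_card_choose_two
  rw [Fintype.card_fin] at h
  exact h.trans (Nat.choose_le_pow n 2)

theorem bddAbove_edgeCounts {W : Type*} (H : SimpleGraph W) (n : ℕ) (x : ℝ) :
    BddAbove (edgeCounts H n x) :=
  ⟨n ^ 2, fun _ he => le_sq_of_mem_edgeCounts he⟩

/-- The Ramsey–Turán number `RT(n, H, x)`: the maximum number of edges of an `n`-vertex `H`-free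
graph with independence number at most `x` (and `0` if there is no such graph). -/
noncomputable def RT {W : Type*} (n : ℕ) (H : SimpleGraph W) (x : ℝ) : ℕ :=
  sSup (edgeCounts H n x)

theorem RT_le_sq {W : Type*} (n : ℕ) (H : SimpleGraph W) (x : ℝ) : RT n H x ≤ n ^ 2 := by
  rcases (edgeCounts H n x).eq_empty_or_nonempty with h | h
  · simp [RT, h]
  · exact csSup_le h fun _ he => le_sq_of_mem_edgeCounts he

theorem RT_div_mem_Icc {W : Type*} (n : ℕ) (H : SimpleGraph W) (x : ℝ) :
    (RT n H x : ℝ) / (n : ℝ) ^ 2 ∈ Set.Icc (0 : ℝ) 1 := by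
  refine ⟨by positivity, div_le_one_of_le₀ ?_ (by positivity)⟩
  exact_mod_cast RT_le_sq n H x

/-- The upper Ramsey–Turán density of `H` with respect to `f`, that is,
`limsup_{n → ∞} RT(n, H, f(n)) / n²`. -/
noncomputable def upperDensity {W : Type*} (H : SimpleGraph W) (f : ℕ → ℝ) : ℝ :=
  limsup (fun n : ℕ => (RT n H (f n) : ℝ) / (n : ℝ) ^ 2) atTop

end RamseyTuran

/-! The upper density is monotone in δ, so the limit at `0⁺` is the infimum over δ > 0, and it
suffices to find, for each η > 0, one δ with density at most 4/15 + η.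

Let G be K₁₃-free with α(G) ≤ δ Q(5,n). For small δ every set of linear size contains a K₅, since
otherwise disjoint copies of it would form a K₅-free graph on at least n vertices with too small an
independence number (`exists_isNClique_of_indepNum_le`). A random graph gives Q(5,n) ≤ n^(9/20)
(`eventually_inverseRamsey_five_le`), and a triangle-free set has at most α(α+1) vertices, so every
set of size n^(19/20) still contains a triangle. This matters because dependent random choice yields
sets of about that size in which all triples have linearly many common neighbours
(`exists_triangle_common_neighbors`).

Apply Szemerédi's regularity lemma. Four pairwise dense clusters give 3+3+3+5 = 14 mutually adjacent
vertices (`exists_isNClique_of_four_dense`), and three with one density above 4/5 give 3+5+5 = 13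
(`exists_isNClique_of_three_dense`). So the reduced graph has no K₄ and its triangles have edge
densities at most about 4/5. A weighted Turán theorem (`sum_sum_le_of_no_four_clique`) bounds the
sum of densities over ordered pairs of the k clusters by about (2/3)(4/5)k², that is, e(G) by about
(4/15)n². -/

open Filter Topology

namespace RamseyTuran

/-! ### Weighted Mantel and Turán theorems -/

section WeightedTuran

variable {ι : Type*} [DecidableEq ι] {w : ι → ι → ℝ}

theorem sum_sum_eq_of_subset (symm : ∀ i j, w i j = w j i) {S T : Finset ι} (h : T ⊆ S) :
    ∑ i ∈ S, ∑ j ∈ S, w i j = ∑ i ∈ S \ T, ∑ j ∈ S \ T, w i j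
      + 2 * ∑ i ∈ S \ T, ∑ j ∈ T, w i j + ∑ i ∈ T, ∑ j ∈ T, w i j := by
  have key : ∀ f : ι → ℝ, ∑ i ∈ S, f i = ∑ i ∈ S \ T, f i + ∑ i ∈ T, f i :=
    fun f => (Finset.sum_sdiff h).symm
  have comm : ∑ i ∈ T, ∑ j ∈ S \ T, w i j = ∑ i ∈ S \ T, ∑ j ∈ T, w i j := by
    rw [Finset.sum_comm]
    exact Finset.sum_congr rfl fun i _ => Finset.sum_congr rfl fun j _ => symm j i
  rw [key]
  simp only [key (w _), Finset.sum_add_distrib]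
  rw [comm]
  ring

/-- A weighted Mantel theorem. -/
theorem sum_sum_le_of_no_triangle (symm : ∀ i j, w i j = w j i)
    (nonneg : ∀ i j, 0 ≤ w i j) (le_one : ∀ i j, w i j ≤ 1) (diag : ∀ i, w i i = 0)
    (S : Finset ι)
    (h3 : ∀ a ∈ S, ∀ b ∈ S, ∀ c ∈ S, 0 < w a b → 0 < w b c → 0 < w a c → False) :
    ∑ i ∈ S, ∑ j ∈ S, w i j ≤ 1 / 2 * (S.card : ℝ) ^ 2 := by
  induction S using Finset.strongInduction with
  | H S ih =>
    by_cases hS : ∃ a ∈ S, ∃ b ∈ S, 0 < w a b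
    · obtain ⟨a, ha, b, hb, hab⟩ := hS
      have hne : a ≠ b := by rintro rfl; simp [diag] at hab
      have hT : ({a, b} : Finset ι) ⊆ S := by simp [Finset.insert_subset_iff, ha, hb]
      rw [sum_sum_eq_of_subset symm hT]
      have h1 := ih (S \ {a, b}) (Finset.sdiff_ssubset hT ⟨a, by simp⟩)
        fun a ha b hb c hc => h3 a (Finset.sdiff_subset ha) b (Finset.sdiff_subset hb) c
          (Finset.sdiff_subset hc)
      have hc : ((S \ {a, b}).card : ℝ) + 2 = S.card := by
        have := Finset.card_sdiff_add_card_eq_card hT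
        rw [Finset.card_pair hne] at this
        exact_mod_cast this
      -- An outside vertex has positive weight to at most one end of the edge, and (s-2)²/2 + 2(s-2)
      -- + 2 = s²/2.
      have h2 : ∑ i ∈ S \ {a, b}, ∑ j ∈ {a, b}, w i j ≤ (S \ {a, b}).card := by
        have : ∀ i ∈ S \ {a, b}, ∑ j ∈ {a, b}, w i j ≤ (1 : ℝ) := by
          intro i hi
          rw [Finset.sum_pair hne]
          have hi := Finset.sdiff_subset hi
          rcases (nonneg i a).eq_or_lt with h | h
          · rw [← h, zero_add]; exact le_one _ _
          rcases (nonneg i b).eq_or_lt with h' | h'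
          · rw [← h', add_zero]; exact le_one _ _
          exact (h3 i hi a ha b hb h hab h').elim
        simpa using Finset.sum_le_card_nsmul _ _ _ this
      have h4 : ∑ i ∈ ({a, b} : Finset ι), ∑ j ∈ {a, b}, w i j ≤ 2 := by
        simp only [Finset.sum_pair hne, diag]
        linarith [le_one a b, le_one b a]
      rw [← hc]
      nlinarith
    · push Not at hS
      refine (Finset.sum_nonpos fun i hi => Finset.sum_nonpos fun j hj => hS i hi j hj).trans ?_
      positivity

/-- A weighted Turán theorem for weights whose support contains no `K₄` and which are at most `β`
on the edges of triangles. -/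
theorem sum_sum_le_of_no_four_clique {β : ℝ} (hβ : 3 / 4 ≤ β) (symm : ∀ i j, w i j = w j i)
    (nonneg : ∀ i j, 0 ≤ w i j) (le_one : ∀ i j, w i j ≤ 1) (diag : ∀ i, w i i = 0)
    (S : Finset ι)
    (h3 : ∀ a ∈ S, ∀ b ∈ S, ∀ c ∈ S, 0 < w a b → 0 < w b c → 0 < w a c → w a b ≤ β)
    (h4 : ∀ a ∈ S, ∀ b ∈ S, ∀ c ∈ S, ∀ d ∈ S, 0 < w a b → 0 < w a c → 0 < w a d → 0 < w b c →
      0 < w b d → 0 < w c d → False) :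
    ∑ i ∈ S, ∑ j ∈ S, w i j ≤ 2 / 3 * β * (S.card : ℝ) ^ 2 := by
  induction S using Finset.strongInduction with
  | H S ih =>
    by_cases hS : ∃ a ∈ S, ∃ b ∈ S, ∃ c ∈ S, 0 < w a b ∧ 0 < w b c ∧ 0 < w a c
    · obtain ⟨a, ha, b, hb, c, hc, hab, hbc, hac⟩ := hS
      have hne {x y : ι} (h : 0 < w x y) : x ≠ y := by rintro rfl; simp [diag] at h
      have sum3 (f : ι → ℝ) : ∑ j ∈ ({a, b, c} : Finset ι), f j = f a + f b + f c := by
        rw [Finset.sum_insert, Finset.sum_pair (hne hbc), add_assoc]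
        simp [hne hab, hne hac]
      have hT : ({a, b, c} : Finset ι) ⊆ S := by simp [Finset.insert_subset_iff, ha, hb, hc]
      rw [sum_sum_eq_of_subset symm hT]
      have sub : S \ {a, b, c} ⊆ S := Finset.sdiff_subset
      have h1 := ih (S \ {a, b, c}) (Finset.sdiff_ssubset hT ⟨a, by simp⟩)
        (fun a ha b hb c hc => h3 a (sub ha) b (sub hb) c (sub hc))
        (fun a ha b hb c hc d hd => h4 a (sub ha) b (sub hb) c (sub hc) d (sub hd))
      have hcard : ((S \ {a, b, c}).card : ℝ) + 3 = S.card := by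
        have := Finset.card_sdiff_add_card_eq_card hT
        rw [Finset.card_eq_three.2 ⟨a, b, c, hne hab, hne hac, hne hbc, rfl⟩] at this
        exact_mod_cast this
      -- Three positive weights from an outside vertex would give a K₄. Two positive ones lie on a
      -- triangle, hence are at most β each; a single one is at most 1 ≤ 2β. The induction closes
      -- with equality: (2/3)β(s-3)² + 4β(s-3) + 6β = (2/3)βs².
      have h2 : ∑ i ∈ S \ {a, b, c}, ∑ j ∈ {a, b, c}, w i j
          ≤ (S \ {a, b, c}).card * (2 * β) := by
        have two {i x y : ι} (hi : i ∈ S) (hx : x ∈ S) (hy : y ∈ S) (hxy : 0 < w x y) :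
            w i x + w i y ≤ 2 * β := by
          rcases (nonneg i x).eq_or_lt with h | h
          · linarith [le_one i y]
          rcases (nonneg i y).eq_or_lt with h' | h'
          · linarith [le_one i x]
          linarith [h3 i hi x hx y hy h hxy h', h3 i hi y hy x hx h' (symm x y ▸ hxy) h]
        have : ∀ i ∈ S \ {a, b, c}, ∑ j ∈ {a, b, c}, w i j ≤ 2 * β := by
          intro i hi
          rw [sum3]
          have hi := sub hi
          rcases (nonneg i a).eq_or_lt with h | h
          · linarith [two hi hb hc hbc]
          rcases (nonneg i b).eq_or_lt with h' | h'
          · linarith [two hi ha hc hac]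
          rcases (nonneg i c).eq_or_lt with h'' | h''
          · linarith [two hi ha hb hab]
          exact (h4 i hi a ha b hb c hc h h' h'' hab hac hbc).elim
        simpa using Finset.sum_le_card_nsmul _ _ _ this
      have h5 : ∑ i ∈ ({a, b, c} : Finset ι), ∑ j ∈ {a, b, c}, w i j ≤ 6 * β := by
        simp only [sum3, diag]
        have hba := symm b a; have hca := symm c a; have hcb := symm c b
        have := h3 a ha b hb c hc hab hbc hac
        have := h3 b hb c hc a ha hbc (hca ▸ hac) (hba ▸ hab)
        have := h3 a ha c hc b hb hac (hcb ▸ hbc) hab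
        linarith
      rw [← hcard]
      nlinarith
    · push Not at hS
      -- Mantel's 1/2 is at most (2/3)β precisely because β ≥ 3/4.
      refine (sum_sum_le_of_no_triangle symm nonneg le_one diag S ?_).trans ?_
      · exact fun a ha b hb c hc h h' h'' => (hS a ha b hb c hc h h').not_gt h''
      · gcongr; linarith

end WeightedTuran

/-! ### Dependent random choice -/

section DependentRandomChoice

theorem card_filter_piFinset_forall {ι β : Type*} [Fintype ι] [DecidableEq ι]
    (B : ι → Finset β) (p : ι → β → Prop) [∀ i, DecidablePred (p i)] :
    ((Fintype.piFinset B).filter fun f => ∀ i, p i (f i)).card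
      = ∏ i, ((B i).filter (p i)).card := by
  rw [← Fintype.card_piFinset]
  congr 1
  ext f
  simp [Fintype.mem_piFinset, forall_and]

open Classical in
/-- Dependent random choice for triples: if every vertex of `A` has many neighbours in `B`, then
a large part of `A` has the property that all its triples have many common neighbours in `B`. -/
theorem exists_subset_forall_triple_le_card {α β : Type*} (r : α → β → Prop) {A : Finset α}
    {B : Finset β} (hB : B.Nonempty) {d ε : ℝ} (hd : 0 ≤ d) (hε : 0 ≤ ε)
    (hdeg : ∀ a ∈ A, d * B.card ≤ (B.filter (r a)).card) (t : ℕ) :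
    ∃ U ⊆ A, (A.card : ℝ) * d ^ t - (A.card : ℝ) ^ 3 * ε ^ t ≤ U.card ∧
      ∀ x ∈ U, ∀ y ∈ U, ∀ z ∈ U,
        ε * B.card ≤ (B.filter fun b => r x b ∧ r y b ∧ r z b).card := by
  set F : Finset (Fin t → β) := Fintype.piFinset fun _ => B with hF
  have hFne : F.Nonempty := Fintype.piFinset_nonempty.2 fun _ => hB
  have hFcard : (F.card : ℝ) = (B.card : ℝ) ^ t := by simp [hF, Fintype.card_piFinset]
  have count (p : β → Prop) :
      ((F.filter fun τ => ∀ i, p (τ i)).card : ℝ) = ((B.filter p).card : ℝ) ^ t := by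
    have := card_filter_piFinset_forall (fun _ : Fin t => B) fun _ => p
    rw [Finset.prod_const, Finset.card_univ, Fintype.card_fin] at this
    rw [← Nat.cast_pow, ← this]
    congr!
  obtain ⟨N, hN⟩ : ∃ N : α × α × α → β → Prop,
      ∀ T b, N T b ↔ r T.1 b ∧ r T.2.1 b ∧ r T.2.2 b := ⟨_, fun _ _ => Iff.rfl⟩
  let bad : Finset (α × α × α) :=
    (A ×ˢ A ×ˢ A).filter fun T => ((B.filter (N T)).card : ℝ) < ε * B.card
  let U₀ (τ : Fin t → β) : Finset α := A.filter fun a => ∀ i, r a (τ i)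
  let bad₀ (τ : Fin t → β) : Finset (α × α × α) := bad.filter fun T => ∀ i, N T (τ i)
  -- Expectation over a uniform τ in Bᵗ, written as double counting: on average `U₀ τ` has at least
  -- |A|dᵗ elements and contains at most |A|³εᵗ bad triples.
  have swap {γ : Type _} (X : Finset γ) (p : γ → β → Prop) :
      ∑ τ ∈ F, ((X.filter fun x => ∀ i, p x (τ i)).card : ℝ)
        = ∑ x ∈ X, ((B.filter (p x)).card : ℝ) ^ t := by
    simp_rw [← count, Finset.card_filter, Nat.cast_sum]
    exact Finset.sum_comm
  have h1 : (F.card : ℝ) * (A.card * d ^ t) ≤ ∑ τ ∈ F, ((U₀ τ).card : ℝ) := by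
    rw [swap, hFcard]
    have : ∀ a ∈ A, (d * B.card) ^ t ≤ ((B.filter (r a)).card : ℝ) ^ t := fun a ha =>
      pow_le_pow_left₀ (by positivity) (hdeg a ha) t
    have := Finset.card_nsmul_le_sum A _ _ this
    rw [nsmul_eq_mul, mul_pow] at this
    linarith
  have h2 : ∑ τ ∈ F, ((bad₀ τ).card : ℝ) ≤ F.card * ((A.card : ℝ) ^ 3 * ε ^ t) := by
    refine le_of_eq_of_le (by convert swap bad N) ?_
    rw [hFcard]
    have : ∀ T ∈ bad, ((B.filter (N T)).card : ℝ) ^ t ≤ (ε * B.card) ^ t := fun T hT =>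
      pow_le_pow_left₀ (by positivity) (Finset.mem_filter.1 hT).2.le t
    refine (Finset.sum_le_card_nsmul bad _ _ this).trans ?_
    have hbad : (bad.card : ℝ) ≤ (A.card : ℝ) ^ 3 := by
      have : bad.card ≤ _ := Finset.card_filter_le _ _
      simp only [Finset.card_product] at this
      calc (bad.card : ℝ) ≤ ((A.card * (A.card * A.card) : ℕ) : ℝ) := by exact_mod_cast this
        _ = _ := by push_cast; ring
    rw [nsmul_eq_mul, mul_pow]
    calc (bad.card : ℝ) * (ε ^ t * (B.card : ℝ) ^ t)
        ≤ (A.card : ℝ) ^ 3 * (ε ^ t * (B.card : ℝ) ^ t) := by gcongr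
      _ = _ := by ring
  obtain ⟨τ, -, hτ⟩ : ∃ τ ∈ F, (A.card : ℝ) * d ^ t - (A.card : ℝ) ^ 3 * ε ^ t
      ≤ ((U₀ τ).card : ℝ) - ((bad₀ τ).card : ℝ) := by
    refine Finset.exists_le_of_sum_le hFne ?_
    rw [Finset.sum_const, nsmul_eq_mul, mul_sub, Finset.sum_sub_distrib]
    linarith
  -- Deleting the first vertex of each surviving bad triple destroys them all.
  refine ⟨U₀ τ \ (bad₀ τ).image Prod.fst,
    Finset.sdiff_subset.trans (Finset.filter_subset _ _), hτ.trans ?_, ?_⟩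
  · have h3 := Finset.le_card_sdiff ((bad₀ τ).image Prod.fst) (U₀ τ)
    have h4 : ((bad₀ τ).image Prod.fst).card ≤ (bad₀ τ).card := Finset.card_image_le
    have h5 : (U₀ τ).card ≤ (U₀ τ \ (bad₀ τ).image Prod.fst).card + (bad₀ τ).card := by omega
    rw [sub_le_iff_le_add]
    exact_mod_cast h5
  · intro x hx y hy z hz
    by_contra! hlt
    obtain ⟨hx, hx'⟩ := Finset.mem_sdiff.1 hx
    have hx := Finset.mem_filter.1 hx
    have hy := Finset.mem_filter.1 (Finset.sdiff_subset hy)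
    have hz := Finset.mem_filter.1 (Finset.sdiff_subset hz)
    refine hx' (Finset.mem_image.2 ⟨(x, y, z), ?_, rfl⟩)
    simp only [bad₀, bad, Finset.mem_filter, Finset.mem_product]
    exact ⟨⟨⟨hx.1, hy.1, hz.1⟩, by simpa only [hN] using hlt⟩,
      fun i => (hN _ _).2 ⟨hx.2 i, hy.2 i, hz.2 i⟩⟩

theorem isLittleO_rpow_rpow_atTop {a b : ℝ} (h : a < b) :
    (fun x : ℝ => x ^ a) =o[atTop] fun x : ℝ => x ^ b := by
  rw [Asymptotics.isLittleO_iff_tendsto' ?_]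
  · have := tendsto_rpow_neg_atTop (sub_pos.2 h)
    refine this.congr' ?_
    filter_upwards [eventually_gt_atTop 0] with x hx
    rw [← Real.rpow_sub hx, neg_sub]
  · filter_upwards [eventually_gt_atTop 0] with x hx h0
    exact ((Real.rpow_pos_of_pos hx b).ne' h0).elim

/-- With Dᵗ of order n^(-1/40), the main term has order n^(39/40), while 120 = 3·40 brings the loss
down to at most 1. -/
theorem eventually_exists_le_mul_pow_sub {D c : ℝ} (hD : 0 < D) (hD1 : D < 1) (hc : 0 < c) :
    ∀ᶠ n : ℕ in atTop, ∃ t : ℕ,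
      (n : ℝ) ^ (19 / 20 : ℝ) ≤ c * n * D ^ t - (n : ℝ) ^ 3 * (D ^ 120) ^ t := by
  have h1 : ∀ᶠ x : ℝ in atTop, x ^ (19 / 20 : ℝ) + 1 ≤ c * D * x ^ (39 / 40 : ℝ) := by
    have ho : (fun x : ℝ => x ^ (19 / 20 : ℝ) + 1) =o[atTop] fun x : ℝ => x ^ (39 / 40 : ℝ) := by
      refine (isLittleO_rpow_rpow_atTop (by norm_num)).add ?_
      simpa using isLittleO_rpow_rpow_atTop (show (0 : ℝ) < 39 / 40 by norm_num)
    filter_upwards [ho.bound (mul_pos hc hD), eventually_gt_atTop 0] with x hx hx0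
    rw [Real.norm_of_nonneg (by positivity), Real.norm_of_nonneg (by positivity)] at hx
    exact hx
  filter_upwards [tendsto_natCast_atTop_atTop.eventually h1, eventually_ge_atTop 1] with n hn hn1
  have hn1 : (1 : ℝ) ≤ n := by exact_mod_cast hn1
  have hn0 : (0 : ℝ) < n := by linarith
  obtain ⟨t, ht, ht'⟩ := exists_nat_pow_near_of_lt_one
    (x := (n : ℝ) ^ (-(1 / 40) : ℝ)) (by positivity)
    (Real.rpow_le_one_of_one_le_of_nonpos hn1 (by norm_num)) hD hD1
  refine ⟨t + 1, ?_⟩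
  have h2 : (D ^ 120) ^ (t + 1) ≤ (n : ℝ) ^ (-3 : ℝ) := by
    rw [pow_right_comm]
    calc (D ^ (t + 1)) ^ 120 ≤ ((n : ℝ) ^ (-(1 / 40) : ℝ)) ^ 120 := by gcongr
      _ = (n : ℝ) ^ (-3 : ℝ) := by
        rw [← Real.rpow_natCast, ← Real.rpow_mul hn0.le]; norm_num
  have h3 : (n : ℝ) ^ 3 * (D ^ 120) ^ (t + 1) ≤ 1 := by
    calc (n : ℝ) ^ 3 * (D ^ 120) ^ (t + 1) ≤ (n : ℝ) ^ 3 * (n : ℝ) ^ (-3 : ℝ) := by gcongr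
      _ = 1 := by
        rw [← Real.rpow_natCast, ← Real.rpow_add hn0]; norm_num
  have h4 : c * D * (n : ℝ) ^ (39 / 40 : ℝ) ≤ c * n * D ^ (t + 1) := by
    have : (n : ℝ) ^ (39 / 40 : ℝ) = n * (n : ℝ) ^ (-(1 / 40) : ℝ) := by
      rw [← Real.rpow_one_add' hn0.le (by norm_num)]; norm_num
    calc c * D * (n : ℝ) ^ (39 / 40 : ℝ) = c * n * D * (n : ℝ) ^ (-(1 / 40) : ℝ) := by
          rw [this]; ring
      _ ≤ c * n * D * D ^ t := by gcongr
      _ = _ := by ring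
  linarith

end DependentRandomChoice

/-! ### Cliques forced by a small independence number -/

section InverseRamsey

open SimpleGraph

theorem inverseRamsey_le {t n k : ℕ} {V : Type*} (G : SimpleGraph V) (S : Finset V)
    (hS : n ≤ S.card) (hfree : ∀ T ⊆ S, ¬ G.IsNClique t T)
    (hind : ∀ T ⊆ S, G.IsIndepSet T → T.card ≤ k) : inverseRamsey t n ≤ k := by
  let f : Fin n ↪ V := (Fin.castLEEmb hS).trans
    (S.equivFin.symm.toEmbedding.trans (Function.Embedding.subtype _))
  have hf (T : Finset (Fin n)) : T.map f ⊆ S := by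
    intro x hx
    obtain ⟨y, -, rfl⟩ := Finset.mem_map.1 hx
    exact (S.equivFin.symm _).2
  have hle : (G.comap f).indepNum ≤ k := by
    obtain ⟨T, hT⟩ := (G.comap f).exists_isNIndepSet_indepNum
    rw [← hT.card_eq, ← Finset.card_map f]
    refine hind _ (hf T) ?_
    rw [Finset.coe_map]
    rintro _ ⟨x, hx, rfl⟩ _ ⟨y, hy, rfl⟩ hxy
    exact hT.isIndepSet hx hy fun h => hxy (h ▸ rfl)
  have hcf : (G.comap f).CliqueFree t := by
    intro T hT
    refine hfree (T.map f) (hf T) (G.isNClique_iff.2 ⟨?_, by rw [Finset.card_map, hT.card_eq]⟩)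
    rw [Finset.coe_map]
    rintro _ ⟨x, hx, rfl⟩ _ ⟨y, hy, rfl⟩ hxy
    exact hT.isClique hx hy fun h => hxy (h ▸ rfl)
  have hmem : (G.comap f).indepNum ∈
      {a : ℕ | ∃ G : SimpleGraph (Fin n), G.CliqueFree t ∧ G.indepNum = a} := ⟨_, hcf, rfl⟩
  exact (Nat.sInf_le hmem).trans hle

/-- The disjoint union of r copies of G[S] is K_t-free, and an independent set meets each copy in at
most α(G) vertices. -/
theorem inverseRamsey_le_mul_indepNum {t n r : ℕ} {V : Type*} [Finite V] (G : SimpleGraph V)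
    (S : Finset V) (hS : n ≤ S.card * r) (hfree : ∀ T ⊆ S, ¬ G.IsNClique t T) :
    inverseRamsey t n ≤ G.indepNum * r := by
  classical
  let H : SimpleGraph (V × Fin r) :=
    { Adj := fun x y => x.2 = y.2 ∧ G.Adj x.1 y.1
      symm := ⟨fun _ _ h => ⟨h.1.symm, h.2.symm⟩⟩
      loopless := ⟨fun x h => G.irrefl h.2⟩ }
  refine inverseRamsey_le H (S ×ˢ Finset.univ) (by simpa using hS) ?_ ?_
  · intro T hTS hT
    refine hfree (T.image Prod.fst) ?_ ⟨?_, ?_⟩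
    · intro x hx
      obtain ⟨y, hy, rfl⟩ := Finset.mem_image.1 hx
      exact (Finset.mem_product.1 (hTS hy)).1
    · rw [Finset.coe_image]
      rintro _ ⟨x, hx, rfl⟩ _ ⟨y, hy, rfl⟩ hxy
      exact (hT.isClique hx hy fun h => hxy (h ▸ rfl)).2
    · rw [Finset.card_image_of_injOn, hT.card_eq]
      intro x hx y hy hxy
      by_contra hne
      exact (hT.isClique hx hy hne).2.ne hxy
  · intro T hTS hT
    have := Finset.card_le_mul_card_image_of_maps_to (s := T) (t := Finset.univ) (f := Prod.snd)
      (fun _ _ => Finset.mem_univ _) G.indepNum ?_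
    · simpa using this
    · intro i _
      rw [← Finset.card_image_of_injOn (f := Prod.fst)]
      · refine IsIndepSet.card_le_indepNum ?_
        rw [Finset.coe_image]
        rintro _ ⟨x, hx, rfl⟩ _ ⟨y, hy, rfl⟩ hxy hadj
        simp only [Finset.coe_filter, Set.mem_ofPred_eq] at hx hy
        exact hT hx.1 hy.1 (fun h => hxy (h ▸ rfl)) ⟨hx.2.trans hy.2.symm, hadj⟩
      · intro x hx y hy hxy
        simp only [Finset.coe_filter, Set.mem_ofPred_eq] at hx hy
        exact Prod.ext hxy (hx.2.trans hy.2.symm)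

theorem inverseRamsey_pos {t n : ℕ} (ht : 2 ≤ t) (hn : 0 < n) : 0 < inverseRamsey t n := by
  obtain ⟨G, -, hG⟩ := exists_indepNum_eq_inverseRamsey ht n
  rw [← hG]
  have : G.IsIndepSet (({⟨0, hn⟩} : Finset (Fin n)) : Set (Fin n)) := by simp
  exact (Finset.card_singleton _).ge.trans this.card_le_indepNum

/-- If `α(G)` is small compared to `Q(t, n)` then every linear-sized set contains a `K_t`. -/
theorem exists_isNClique_of_indepNum_le {t n : ℕ} (ht : 2 ≤ t) {c δ : ℝ} (hc : 0 < c)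
    (hδ : 0 < δ) (hδc : δ * (1 / c + 1) < 1) (G : SimpleGraph (Fin n))
    (hG : (G.indepNum : ℝ) ≤ δ * inverseRamsey t n) (S : Finset (Fin n)) (hn : 0 < n)
    (hS : c * n ≤ S.card) : ∃ T ⊆ S, G.IsNClique t T := by
  by_contra! hfree
  have hn' : (0 : ℝ) < n := by exact_mod_cast hn
  have hSpos : (0 : ℝ) < S.card := lt_of_lt_of_le (by positivity) hS
  -- Take r = ⌈n/|S|⌉ copies; r ≤ 1/c + 1 does not depend on n.
  have hle : n ≤ S.card * ⌈(n : ℝ) / S.card⌉₊ := by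
    have := Nat.le_ceil ((n : ℝ) / S.card)
    rw [div_le_iff₀ hSpos, mul_comm] at this
    exact_mod_cast this
  have h1 : (inverseRamsey t n : ℝ) ≤ G.indepNum * ⌈(n : ℝ) / S.card⌉₊ := by
    exact_mod_cast inverseRamsey_le_mul_indepNum G S hle hfree
  have h2 : (⌈(n : ℝ) / S.card⌉₊ : ℝ) ≤ 1 / c + 1 := by
    refine (Nat.ceil_lt_add_one (by positivity)).le.trans ?_
    gcongr ?_ + 1
    rw [div_le_div_iff₀ hSpos hc]
    linarith
  have hQ : (0 : ℝ) < inverseRamsey t n := by exact_mod_cast inverseRamsey_pos ht hn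
  have h3 : (inverseRamsey t n : ℝ) ≤ δ * inverseRamsey t n * (1 / c + 1) :=
    h1.trans (by gcongr)
  nlinarith

/-- A set spanning no triangle has at most `α(α + 1)` vertices. -/
theorem card_le_of_forall_not_isNClique_three {V : Type*} [Finite V] (G : SimpleGraph V)
    (S : Finset V) (hfree : ∀ T ⊆ S, ¬ G.IsNClique 3 T) :
    S.card ≤ G.indepNum * (G.indepNum + 1) := by
  classical
  obtain ⟨I, hI, hmax⟩ := Finset.exists_max_image
    (S.powerset.filter fun I : Finset V => G.IsIndepSet (I : Set V)) Finset.card ⟨∅, by simp⟩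
  simp only [Finset.mem_filter, Finset.mem_powerset] at hI hmax
  obtain ⟨hIS, hI⟩ := hI
  -- By maximality of I its closed neighbourhoods cover S; each open neighbourhood within S is
  -- independent because S spans no triangle.
  have hcover : S ⊆ I.biUnion fun v => insert v (S.filter (G.Adj v)) := by
    intro x hx
    by_contra hx'
    simp only [Finset.mem_biUnion, Finset.mem_insert, Finset.mem_filter, not_exists, not_and,
      not_or] at hx'
    have hxI : x ∉ I := fun h => (hx' x h).1 rfl
    have := hmax (insert x I) ⟨Finset.insert_subset hx hIS, ?_⟩
    · rw [Finset.card_insert_of_notMem hxI] at this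
      omega
    · rw [Finset.coe_insert]
      refine hI.insert fun v hv _ => ?_
      exact ⟨fun h => (hx' v hv).2 hx h.symm, fun h => (hx' v hv).2 hx h⟩
  calc S.card ≤ _ := Finset.card_le_card hcover
    _ ≤ I.card * (G.indepNum + 1) := by
      refine Finset.card_biUnion_le_card_mul _ _ _ fun v hv => ?_
      refine (Finset.card_insert_le _ _).trans (Nat.add_le_add_right ?_ 1)
      refine IsIndepSet.card_le_indepNum ?_
      intro x hx y hy hxy hadj
      simp only [Finset.coe_filter, Set.mem_ofPred_eq] at hx hy
      refine hfree {v, x, y} ?_ (is3Clique_triple_iff.2 ⟨hx.2, hy.2, hadj⟩)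
      simp [Finset.insert_subset_iff, hx.1, hy.1, hIS hv]
    _ ≤ _ := Nat.mul_le_mul_right _ hI.card_le_indepNum

end InverseRamsey

/-! ### A random-graph upper bound for Q(5,n) -/

section RandomGraph

open SimpleGraph

/-- The graph of the pairs of colour `0` in a colouring of all pairs. -/
def colorGraph {V : Type*} {q : ℕ} (ω : Sym2 V → Fin (q + 1)) : SimpleGraph V where
  Adj u v := u ≠ v ∧ ω s(u, v) = 0
  symm := ⟨fun _ _ h => ⟨h.1.symm, by rw [Sym2.eq_swap]; exact h.2⟩⟩
  loopless := ⟨fun _ h => h.1 rfl⟩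

open Classical in
theorem card_filter_forall_mem {E β : Type*} [Fintype E] [Fintype β] [Nonempty β] (F : Finset E)
    (C : Finset β) :
    ((Finset.univ.filter fun ω : E → β => ∀ e ∈ F, ω e ∈ C).card : ℝ)
      = ((C.card : ℝ) / Fintype.card β) ^ F.card * Fintype.card (E → β) := by
  have h := card_filter_piFinset_forall (fun _ : E => (Finset.univ : Finset β))
    fun e b => e ∈ F → b ∈ C
  rw [Fintype.piFinset_univ] at h
  have h' : ∀ e : E, (((Finset.univ.filter fun b : β => e ∈ F → b ∈ C).card : ℕ) : ℝ)
      = (if e ∈ F then (C.card : ℝ) / Fintype.card β else 1) * Fintype.card β := by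
    intro e
    have : (Fintype.card β : ℝ) ≠ 0 := by exact_mod_cast Fintype.card_ne_zero
    by_cases he : e ∈ F
    · simp [he, this]
    · simp [he]
  calc _ = (((Finset.univ.filter fun ω : E → β => ∀ e, e ∈ F → ω e ∈ C).card : ℕ) : ℝ) := by
        congr!
    _ = _ := by
      rw [h, Nat.cast_prod]
      simp_rw [h']
      rw [Finset.prod_mul_distrib, Finset.prod_ite_mem]
      simp [div_pow]

open Classical in
theorem card_filter_forall_pairs_mem {V : Type*} [Fintype V] {q : ℕ} (s : Finset V)
    (C : Finset (Fin (q + 1))) :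
    ((Finset.univ.filter fun ω : Sym2 V → Fin (q + 1) =>
        ∀ u ∈ s, ∀ v ∈ s, u ≠ v → ω s(u, v) ∈ C).card : ℝ)
      = ((C.card : ℝ) / (q + 1)) ^ (s.card.choose 2) * Fintype.card (Sym2 V → Fin (q + 1)) := by
  have := card_filter_forall_mem (β := Fin (q + 1)) (s.offDiag.image Sym2.mk.uncurry) C
  rw [Sym2.card_image_offDiag, Fintype.card_fin] at this
  push_cast at this
  refine Eq.trans ?_ (this.trans ?_)
  · congr! 2
    ext ω
    simp only [Finset.mem_filter, Finset.mem_univ, true_and, Finset.mem_image, Finset.mem_offDiag,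
      Prod.exists, Function.uncurry_apply_pair]
    constructor
    · rintro h _ ⟨u, v, ⟨hu, hv, huv⟩, rfl⟩
      exact h u hu v hv huv
    · exact fun h u hu v hv huv => h _ ⟨u, v, ⟨hu, hv, huv⟩, rfl⟩
  · congr!

open Classical in
/-- The deletion method. -/
theorem inverseRamsey_five_le {n q k : ℕ}
    (h : ((2 * n).choose 5 : ℝ) * (1 / (q + 1)) ^ 10
      + 2 * n * ((2 * n).choose k * (q / (q + 1)) ^ (k.choose 2)) < n) :
    inverseRamsey 5 n ≤ k := by
  let Ω := Sym2 (Fin (2 * n)) → Fin (q + 1)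
  let cl (ω : Ω) : Finset (Finset (Fin (2 * n))) :=
    (Finset.univ.powersetCard 5).filter fun s => (colorGraph ω).IsClique (s : Set (Fin (2 * n)))
  let ind (ω : Ω) : Finset (Finset (Fin (2 * n))) :=
    (Finset.univ.powersetCard k).filter fun s => (colorGraph ω).IsIndepSet (s : Set (Fin (2 * n)))
  have hcl : ∑ ω : Ω, ((cl ω).card : ℝ)
      ≤ Fintype.card Ω * (((2 * n).choose 5 : ℝ) * (1 / (q + 1)) ^ 10) := by
    simp_rw [cl, Finset.card_filter, Nat.cast_sum]
    rw [Finset.sum_comm]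
    have : ∀ s ∈ Finset.powersetCard 5 (Finset.univ : Finset (Fin (2 * n))),
        ∑ ω : Ω, (((if (colorGraph ω).IsClique (s : Set (Fin (2 * n))) then 1 else 0 : ℕ)) : ℝ)
          ≤ Fintype.card Ω * (1 / (q + 1)) ^ 10 := by
      intro s hs
      have hs := (Finset.mem_powersetCard.1 hs).2
      rw [← Nat.cast_sum, ← Finset.card_filter]
      have := card_filter_forall_pairs_mem s ({0} : Finset (Fin (q + 1)))
      rw [hs, show Nat.choose 5 2 = 10 from rfl, Finset.card_singleton, Nat.cast_one] at this
      rw [mul_comm (Fintype.card Ω : ℝ)]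
      refine le_of_le_of_eq (Nat.cast_le.2 ?_) (this.trans (by congr!))
      refine Finset.card_le_card fun ω hω => ?_
      simp only [Finset.mem_filter, Finset.mem_univ, true_and, Finset.mem_singleton] at hω ⊢
      exact fun u hu v hv huv => (hω hu hv huv).2
    refine (Finset.sum_le_card_nsmul _ _ _ this).trans_eq ?_
    rw [Finset.card_powersetCard, Finset.card_univ, Fintype.card_fin, nsmul_eq_mul]
    ring
  have hind : ∑ ω : Ω, ((ind ω).card : ℝ)
      ≤ Fintype.card Ω * (((2 * n).choose k : ℝ) * (q / (q + 1)) ^ (k.choose 2)) := by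
    simp_rw [ind, Finset.card_filter, Nat.cast_sum]
    rw [Finset.sum_comm]
    have : ∀ s ∈ Finset.powersetCard k (Finset.univ : Finset (Fin (2 * n))),
        ∑ ω : Ω, (((if (colorGraph ω).IsIndepSet (s : Set (Fin (2 * n))) then 1 else 0 : ℕ)) : ℝ)
          ≤ Fintype.card Ω * (q / (q + 1)) ^ (k.choose 2) := by
      intro s hs
      have hs := (Finset.mem_powersetCard.1 hs).2
      rw [← Nat.cast_sum, ← Finset.card_filter]
      have := card_filter_forall_pairs_mem s ({0}ᶜ : Finset (Fin (q + 1)))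
      rw [hs, Finset.card_compl, Finset.card_singleton, Fintype.card_fin,
        Nat.add_sub_cancel] at this
      rw [mul_comm (Fintype.card Ω : ℝ)]
      refine le_of_le_of_eq (Nat.cast_le.2 ?_) (this.trans (by congr!))
      refine Finset.card_le_card fun ω hω => ?_
      simp only [Finset.mem_filter, Finset.mem_univ, true_and, Finset.mem_compl,
        Finset.mem_singleton] at hω ⊢
      exact fun u hu v hv huv h0 => hω hu hv huv ⟨huv, h0⟩
    refine (Finset.sum_le_card_nsmul _ _ _ this).trans_eq ?_
    rw [Finset.card_powersetCard, Finset.card_univ, Fintype.card_fin, nsmul_eq_mul]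
    ring
  -- The weight 2n lets one averaging control both counts: a single independent k-set would already
  -- exceed n, so there is none, and fewer than n copies of K₅ remain.
  obtain ⟨ω, -, hω⟩ : ∃ ω ∈ (Finset.univ : Finset Ω),
      ((cl ω).card : ℝ) + 2 * n * (ind ω).card < n := by
    refine Finset.exists_lt_of_sum_lt ?_
    rw [Finset.sum_add_distrib, ← Finset.mul_sum, Finset.sum_const, nsmul_eq_mul,
      Finset.card_univ]
    have hpos : (0 : ℝ) < Fintype.card Ω := by exact_mod_cast Fintype.card_pos
    calc _ ≤ (Fintype.card Ω : ℝ) * (((2 * n).choose 5 : ℝ) * (1 / (q + 1)) ^ 10)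
          + 2 * n * (Fintype.card Ω * (((2 * n).choose k : ℝ) * (q / (q + 1)) ^ (k.choose 2))) := by
          gcongr
      _ = Fintype.card Ω * (((2 * n).choose 5 : ℝ) * (1 / (q + 1)) ^ 10
          + 2 * n * ((2 * n).choose k * (q / (q + 1)) ^ (k.choose 2))) := by ring
      _ < _ := by gcongr
  have hω : (cl ω).card + 2 * n * (ind ω).card < n := by exact_mod_cast hω
  have hind0 : ind ω = ∅ := by
    rw [← Finset.card_eq_zero]
    by_contra h0
    nlinarith [Nat.pos_of_ne_zero h0]
  have hmem : ∀ s ∈ cl ω, s.Nonempty := fun s hs => by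
    rw [← Finset.card_pos, (Finset.mem_powersetCard.1 (Finset.mem_filter.1 hs).1).2]
    norm_num
  have : Nonempty (Fin (2 * n)) := ⟨⟨0, by omega⟩⟩
  -- Remove one vertex from each K₅; more than n of the 2n vertices survive.
  choose! g hg using hmem
  refine inverseRamsey_le (colorGraph ω) (Finset.univ \ (cl ω).image g) ?_ ?_ ?_
  · have h1 := Finset.le_card_sdiff ((cl ω).image g) Finset.univ
    have h2 : ((cl ω).image g).card ≤ (cl ω).card := Finset.card_image_le
    rw [Finset.card_univ, Fintype.card_fin] at h1
    omega
  · intro T hT hcT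
    have hTcl : T ∈ cl ω := Finset.mem_filter.2
      ⟨Finset.mem_powersetCard.2 ⟨Finset.subset_univ _, hcT.card_eq⟩, hcT.isClique⟩
    exact (Finset.mem_sdiff.1 (hT (hg T hTcl))).2 (Finset.mem_image_of_mem g hTcl)
  · intro T _ hiT
    by_contra! hlt
    obtain ⟨T', hT'T, hT'⟩ := Finset.exists_subset_card_eq hlt.le
    have : T' ∈ ind ω := Finset.mem_filter.2
      ⟨Finset.mem_powersetCard.2 ⟨Finset.subset_univ _, hT'⟩,
        hiT.mono (by exact_mod_cast hT'T)⟩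
    simp [hind0] at this

/-- On N = 2n vertices use edge probability 1/Q with Q of order N^(2/5). The expected number of K₅
is at most N⁵/120 · N⁻⁴ = n/60, and independent k-sets are negligible once k is well above Q log N.
Any exponent strictly between 2/5 and 1/2 would serve the overall argument; 9/20 leaves room for the
logarithm while α² stays well below n. -/
theorem eventually_inverseRamsey_five_le :
    ∀ᶠ n : ℕ in atTop, (inverseRamsey 5 n : ℝ) ≤ (n : ℝ) ^ (9 / 20 : ℝ) := by
  -- Here 17/40 = 2/5 + 1/40, the 1/40 absorbing log N; 640 = 4·2·40·2 collects the constants in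
  -- `hQlog`, and the 2 pays for the floor and for k - 1.
  have h1 : ∀ᶠ x : ℝ in atTop, 640 * x ^ (17 / 40 : ℝ) + 2 ≤ x ^ (9 / 20 : ℝ) := by
    have ho : (fun x : ℝ => 640 * x ^ (17 / 40 : ℝ) + 2) =o[atTop]
        fun x : ℝ => x ^ (9 / 20 : ℝ) := by
      refine ((isLittleO_rpow_rpow_atTop (by norm_num)).const_mul_left _).add ?_
      simpa using (isLittleO_rpow_rpow_atTop (show (0 : ℝ) < 9 / 20 by norm_num)).const_mul_left 2
    filter_upwards [ho.bound one_pos, eventually_gt_atTop 0] with x hx hx0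
    rwa [Real.norm_of_nonneg (by positivity), Real.norm_of_nonneg (by positivity), one_mul] at hx
  filter_upwards [tendsto_natCast_atTop_atTop.eventually h1, eventually_ge_atTop 2] with n hn hn2
  have hn2 : (2 : ℝ) ≤ n := by exact_mod_cast hn2
  have hn0 : (0 : ℝ) < n := by linarith
  set k := ⌊(n : ℝ) ^ (9 / 20 : ℝ)⌋₊ with hk
  have hkle : (k : ℝ) ≤ (n : ℝ) ^ (9 / 20 : ℝ) := Nat.floor_le (by positivity)
  have hklt : (n : ℝ) ^ (9 / 20 : ℝ) < k + 1 := Nat.lt_floor_add_one _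
  set N : ℝ := 2 * n with hN
  have hN1 : 1 ≤ N := by linarith
  have hN0 : 0 < N := by linarith
  set q := ⌊N ^ (2 / 5 : ℝ)⌋₊ with hq
  set Q : ℝ := (q : ℝ) + 1 with hQ
  have hQ0 : 0 < Q := by positivity
  have hQlt : N ^ (2 / 5 : ℝ) < Q := Nat.lt_floor_add_one _
  have hQle : Q ≤ 2 * N ^ (2 / 5 : ℝ) := by
    have : (q : ℝ) ≤ N ^ (2 / 5 : ℝ) := Nat.floor_le (by positivity)
    linarith [Real.one_le_rpow hN1 (show (0 : ℝ) ≤ 2 / 5 by norm_num)]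
  have hlog : Real.log N ≤ 40 * N ^ (1 / 40 : ℝ) := by
    have := Real.log_le_rpow_div hN0.le (show (0 : ℝ) < 1 / 40 by norm_num)
    linarith
  have hlog0 : 0 ≤ Real.log N := Real.log_nonneg hN1
  have hQlog : 4 * Q * Real.log N ≤ k - 1 := by
    have hN17 : N ^ (17 / 40 : ℝ) ≤ 2 * (n : ℝ) ^ (17 / 40 : ℝ) := by
      rw [hN, Real.mul_rpow (by norm_num) hn0.le]
      gcongr
      calc (2 : ℝ) ^ (17 / 40 : ℝ) ≤ 2 ^ (1 : ℝ) :=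
            Real.rpow_le_rpow_of_exponent_le (by norm_num) (by norm_num)
        _ = 2 := Real.rpow_one 2
    have : N ^ (2 / 5 : ℝ) * N ^ (1 / 40 : ℝ) = N ^ (17 / 40 : ℝ) := by
      rw [← Real.rpow_add hN0]; norm_num
    calc 4 * Q * Real.log N ≤ 4 * (2 * N ^ (2 / 5 : ℝ)) * (40 * N ^ (1 / 40 : ℝ)) := by gcongr
      _ = 320 * (N ^ (2 / 5 : ℝ) * N ^ (1 / 40 : ℝ)) := by ring
      _ ≤ k - 1 := by rw [this]; linarith
  have hk1 : (1 : ℝ) ≤ k := by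
    have : 0 ≤ 4 * Q * Real.log N := by positivity
    linarith
  refine le_trans ?_ hkle
  rw [Nat.cast_le]
  refine inverseRamsey_five_le (q := q) ?_
  have hcl : ((2 * n).choose 5 : ℝ) * (1 / Q) ^ 10 ≤ (n : ℝ) / 60 := by
    have h2 : ((2 * n).choose 5 : ℝ) ≤ N ^ 5 / 120 := by
      have := Nat.choose_le_pow_div (α := ℝ) 5 (2 * n)
      push_cast at this
      simpa [Nat.factorial] using this
    have h3 : N ^ 4 ≤ Q ^ 10 := by
      calc N ^ 4 = (N ^ (2 / 5 : ℝ)) ^ 10 := by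
            rw [← Real.rpow_natCast, ← Real.rpow_natCast, ← Real.rpow_mul hN0.le]; norm_num
        _ ≤ Q ^ 10 := by gcongr
    calc ((2 * n).choose 5 : ℝ) * (1 / Q) ^ 10 ≤ N ^ 5 / 120 * (1 / N ^ 4) := by
          rw [one_div_pow]; gcongr
      _ = (n : ℝ) / 60 := by rw [hN]; field_simp; ring
  have hind : N * ((2 * n).choose k * ((q : ℝ) / Q) ^ (k.choose 2)) ≤ 1 := by
    have h2 : ((2 * n).choose k : ℝ) ≤ N ^ k := by
      have := Nat.choose_le_pow (2 * n) k
      calc ((2 * n).choose k : ℝ) ≤ ((2 * n) ^ k : ℕ) := by exact_mod_cast this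
        _ = N ^ k := by push_cast; rfl
    have h3 : (q : ℝ) / Q ≤ Real.exp (-(1 / Q)) := by
      have := Real.add_one_le_exp (-(1 / Q))
      have h4 : (q : ℝ) / Q = -(1 / Q) + 1 := by
        rw [hQ]; field_simp; ring
      rwa [h4]
    have h5 : ((k.choose 2 : ℕ) : ℝ) * (1 / Q) ≥ 2 * k * Real.log N := by
      rw [Nat.cast_choose_two, ge_iff_le, mul_one_div, le_div_iff₀ hQ0]
      nlinarith
    calc N * ((2 * n).choose k * ((q : ℝ) / Q) ^ (k.choose 2))
        ≤ N * (N ^ k * Real.exp (-(1 / Q)) ^ (k.choose 2)) := by gcongr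
      _ = Real.exp (Real.log N) * (Real.exp (Real.log N) ^ k
          * Real.exp (-(1 / Q)) ^ (k.choose 2)) := by rw [Real.exp_log hN0]
      _ = Real.exp (Real.log N + (k * Real.log N + (k.choose 2 : ℕ) * -(1 / Q))) := by
        rw [← Real.exp_nat_mul, ← Real.exp_nat_mul, Real.exp_add, Real.exp_add]
      _ ≤ 1 := by
        rw [Real.exp_le_one_iff]
        nlinarith
  have : (n : ℝ) / 60 + 1 < n := by linarith
  linarith

end RandomGraph

/-! ### Embedding cliques in dense pairs -/

section Embedding

open SimpleGraph

open Classical in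
/-- Every pair of subsets of `A` and `B` with at least `m` elements has density at least `d`. -/
def IsDense {V : Type*} (G : SimpleGraph V) (m d : ℝ) (A B : Finset V) : Prop :=
  ∀ A' ⊆ A, ∀ B' ⊆ B, m ≤ A'.card → m ≤ B'.card →
    d * (A'.card * B'.card) ≤ (G.interedges A' B').card

variable {V : Type*} {G : SimpleGraph V} {m d : ℝ} {A B : Finset V}

/-- Since the threshold m is absolute rather than a proportion of the sets, passing to subsets costs
nothing. -/
theorem IsDense.mono {A' B' : Finset V} (h : IsDense G m d A B) (hA : A' ⊆ A) (hB : B' ⊆ B) :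
    IsDense G m d A' B' :=
  fun _ hA' _ hB' => h _ (hA'.trans hA) _ (hB'.trans hB)

-- If m vertices of A had low degree, they would form with B a pair violating the density bound.
open Classical in
theorem IsDense.card_lowDegree_lt (h : IsDense G m d A B) (hm : 0 < m) (hB : m ≤ B.card) :
    ((A.filter fun a => ((B.filter (G.Adj a)).card : ℝ) < d * B.card).card : ℝ) < m := by
  by_contra! hle
  set A' := A.filter fun a => ((B.filter (G.Adj a)).card : ℝ) < d * B.card
  have h1 := h A' (Finset.filter_subset _ _) B subset_rfl hle hB
  have h2 : (G.interedges A' B).card = ∑ a ∈ A', (B.filter (G.Adj a)).card := by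
    rw [interedges_def, Finset.card_filter, Finset.sum_product]
    simp_rw [Finset.card_filter]
  have h3 : ∑ a ∈ A', ((B.filter (G.Adj a)).card : ℝ) < ∑ a ∈ A', d * B.card := by
    refine Finset.sum_lt_sum_of_nonempty ?_ fun a ha => (Finset.mem_filter.1 ha).2
    rw [← Finset.card_pos, ← Nat.cast_pos (α := ℝ)]
    linarith
  rw [h2, Nat.cast_sum] at h1
  rw [Finset.sum_const, nsmul_eq_mul] at h3
  linarith

theorem isNClique_union [DecidableEq V] {a b : ℕ} {S T : Finset V} (hS : G.IsNClique a S)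
    (hT : G.IsNClique b T) (hST : ∀ x ∈ S, ∀ y ∈ T, G.Adj x y) : G.IsNClique (a + b) (S ∪ T) := by
  refine ⟨?_, ?_⟩
  · rw [Finset.coe_union]
    rintro x (hx | hx) y (hy | hy) hxy
    · exact hS.isClique hx hy hxy
    · exact hST x hx y hy
    · exact (hST y hy x hx).symm
    · exact hT.isClique hx hy hxy
  · rw [Finset.card_union_of_disjoint, hS.card_eq, hT.card_eq]
    exact Finset.disjoint_left.2 fun x hx hx' => G.irrefl (hST x hx x hx')

open Classical in
/-- In a pair of density above `4 / 5`, two sets `K₅` can be joined completely. -/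
theorem IsDense.exists_isNClique_ten {s : ℝ} (h : IsDense G m d A B) (hm : 0 < m)
    (hB : m ≤ B.card) (hA : m + s ≤ A.card) (hs : s ≤ (5 * d - 4) * B.card)
    (hK : ∀ S : Finset V, s ≤ S.card → ∃ T ⊆ S, G.IsNClique 5 T) :
    ∃ T : Finset V, (∀ x ∈ T, x ∈ A ∨ x ∈ B) ∧ G.IsNClique 10 T := by
  have hlow := h.card_lowDegree_lt hm hB
  have hsum := Finset.card_filter_add_card_filter_not (s := A)
    fun a => ((B.filter (G.Adj a)).card : ℝ) < d * B.card
  have hsum : ((A.filter fun a => ((B.filter (G.Adj a)).card : ℝ) < d * B.card).card : ℝ)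
    + (A.filter fun a => ¬ ((B.filter (G.Adj a)).card : ℝ) < d * B.card).card = A.card := by
    exact_mod_cast hsum
  obtain ⟨T, hTA, hT⟩ := hK
    (A.filter fun a => ¬ ((B.filter (G.Adj a)).card : ℝ) < d * B.card) (by linarith)
  set C := B.filter fun b => ∀ a ∈ T, G.Adj a b with hC
  -- Each of the five vertices misses at most (1-d)|B| of B, so |C| ≥ (5d-4)|B|: this is where 4/5
  -- comes from.
  have hcover : B ⊆ C ∪ T.biUnion fun a => B.filter fun b => ¬ G.Adj a b := by
    intro b hb
    by_cases hb' : ∀ a ∈ T, G.Adj a b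
    · exact Finset.mem_union_left _ (Finset.mem_filter.2 ⟨hb, hb'⟩)
    · push Not at hb'
      obtain ⟨a, ha, hab⟩ := hb'
      exact Finset.mem_union_right _
        (Finset.mem_biUnion.2 ⟨a, ha, Finset.mem_filter.2 ⟨hb, hab⟩⟩)
  have hcard : (B.card : ℝ) ≤ C.card + ∑ a ∈ T, ((B.filter fun b => ¬ G.Adj a b).card : ℝ) := by
    have := (Finset.card_le_card hcover).trans (Finset.card_union_le _ _)
    have := this.trans (Nat.add_le_add_left Finset.card_biUnion_le _)
    exact_mod_cast this
  have hnon : ∀ a ∈ T, ((B.filter fun b => ¬ G.Adj a b).card : ℝ) ≤ (1 - d) * B.card := by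
    intro a ha
    have h1 := (Finset.mem_filter.1 (hTA ha)).2
    have h2 := Finset.card_filter_add_card_filter_not (s := B) (G.Adj a)
    have h2 : ((B.filter (G.Adj a)).card : ℝ) + (B.filter fun b => ¬ G.Adj a b).card = B.card := by
      exact_mod_cast h2
    linarith
  have := Finset.sum_le_card_nsmul _ _ _ hnon
  rw [hT.card_eq, nsmul_eq_mul] at this
  push_cast at this
  obtain ⟨T', hT'C, hT'⟩ := hK C (by linarith)
  refine ⟨T ∪ T', fun x hx => (Finset.mem_union.1 hx).imp
    (fun h => Finset.filter_subset _ _ (hTA h)) (fun h => Finset.filter_subset _ _ (hT'C h)), ?_⟩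
  exact isNClique_union hT hT' fun x hx y hy => (Finset.mem_filter.1 (hT'C hy)).2 x hx

open Classical in
/-- If sets of size `n ^ (19 / 20)` contain triangles, then `A` contains a triangle with many common
neighbours in each of three sets to which `A` is densely joined. -/
theorem exists_triangle_common_neighbors {d : ℝ} (hd : 0 < d) (hd1 : d < 1) :
    ∃ ρ : ℝ, 0 < ρ ∧ ρ ≤ 1 ∧ ∀ c : ℝ, 0 < c → ∀ᶠ n : ℕ in atTop, ∀ G : SimpleGraph (Fin n),
      (∀ S : Finset (Fin n), (n : ℝ) ^ (19 / 20 : ℝ) ≤ S.card → ∃ T ⊆ S, G.IsNClique 3 T) →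
      ∀ (A : Finset (Fin n)) (B : Fin 3 → Finset (Fin n)) (m : ℝ), 0 < m → c * n ≤ A.card →
        6 * m ≤ A.card → (∀ i, m ≤ (B i).card) → (∀ i, IsDense G m d A (B i)) →
        ∃ T ⊆ A, G.IsNClique 3 T ∧
          ∀ i, ρ * (B i).card ≤ ((B i).filter fun v => ∀ x ∈ T, G.Adj x v).card := by
  have hD0 : 0 < d ^ 3 := by positivity
  have hD1 : d ^ 3 < 1 := pow_lt_one₀ hd.le hd1 (by norm_num)
  refine ⟨(d ^ 3) ^ 120, by positivity, pow_le_one₀ hD0.le hD1.le, fun c hc => ?_⟩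
  filter_upwards [eventually_exists_le_mul_pow_sub hD0 hD1 (half_pos hc)] with n hn
  obtain ⟨t, ht⟩ := hn
  intro G hK A B m hm hA hA6 hB hdense
  set ρ := (d ^ 3) ^ 120 with hρ
  have hρ0 : 0 < ρ := by positivity
  -- At most 3m vertices of A are atypical for some `B i`, at most half of A.
  set A' := A.filter fun a => ∀ i, d * (B i).card ≤ ((B i).filter (G.Adj a)).card with hA'
  have hA'card : c / 2 * n ≤ A'.card := by
    have hcover : A ⊆ A' ∪ Finset.univ.biUnion fun i : Fin 3 =>
        A.filter fun a => (((B i).filter (G.Adj a)).card : ℝ) < d * (B i).card := by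
      intro a ha
      by_cases h : ∀ i, d * (B i).card ≤ ((B i).filter (G.Adj a)).card
      · exact Finset.mem_union_left _ (Finset.mem_filter.2 ⟨ha, h⟩)
      · push Not at h
        obtain ⟨i, hi⟩ := h
        exact Finset.mem_union_right _
          (Finset.mem_biUnion.2 ⟨i, Finset.mem_univ _, Finset.mem_filter.2 ⟨ha, hi⟩⟩)
    have h1 : (A.card : ℝ) ≤ A'.card + ∑ i : Fin 3,
        ((A.filter fun a => (((B i).filter (G.Adj a)).card : ℝ) < d * (B i).card).card : ℝ) := by
      have := (Finset.card_le_card hcover).trans (Finset.card_union_le _ _)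
      have := this.trans (Nat.add_le_add_left Finset.card_biUnion_le _)
      exact_mod_cast this
    have h2 : ∑ i : Fin 3,
        ((A.filter fun a => (((B i).filter (G.Adj a)).card : ℝ) < d * (B i).card).card : ℝ)
          ≤ 3 * m := by
      have := Finset.sum_le_card_nsmul Finset.univ _ m
        fun i _ => ((hdense i).card_lowDegree_lt hm (hB i)).le
      simpa using this
    linarith
  -- Choosing from the product of the three sets treats them at once: degrees have density at least
  -- d³, and a common neighbourhood in P is the product of those in the `B i`. As no factor exceeds
  -- |`B i`|, a ρ-fraction of P forces a ρ-fraction of each `B i`.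
  set P := Fintype.piFinset B with hP
  have hBpos : ∀ i, (0 : ℝ) < (B i).card := fun i => hm.trans_le (hB i)
  have hPcard : (P.card : ℝ) = ∏ i, ((B i).card : ℝ) := by
    rw [hP, Fintype.card_piFinset, Nat.cast_prod]
  have hPne : P.Nonempty := Fintype.piFinset_nonempty.2 fun i => by
    rw [← Finset.card_pos]; exact_mod_cast hBpos i
  have hcount (p : Fin 3 → Fin n → Prop) {X : Finset (Fin 3 → Fin n)}
      (hX : ∀ f, f ∈ X ↔ f ∈ P ∧ ∀ i, p i (f i)) :
      (X.card : ℝ) = ∏ i, (((B i).filter (p i)).card : ℝ) := by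
    rw [← Nat.cast_prod, ← card_filter_piFinset_forall]
    congr 2
    ext f
    simp [hX, hP]
  obtain ⟨U, hUA, hU, hUT⟩ := exists_subset_forall_triple_le_card
    (fun (a : Fin n) (f : Fin 3 → Fin n) => ∀ i, G.Adj a (f i)) (A := A') hPne hD0.le hρ0.le
    (fun a ha => by
      refine le_of_le_of_eq ?_ (hcount (fun _ => G.Adj a) (by simp)).symm
      rw [hPcard]
      have : d ^ 3 * ∏ i, ((B i).card : ℝ) = ∏ i, d * ((B i).card : ℝ) := by
        rw [Finset.prod_mul_distrib]; simp
      rw [this]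
      exact Finset.prod_le_prod (fun i _ => by positivity)
        fun i _ => (Finset.mem_filter.1 ha).2 i) t
  have hUcard : (n : ℝ) ^ (19 / 20 : ℝ) ≤ U.card := by
    refine ht.trans (le_trans ?_ hU)
    have : (A'.card : ℝ) ≤ n := by
      exact_mod_cast (Finset.card_le_univ A').trans_eq (Fintype.card_fin n)
    gcongr
  obtain ⟨T, hTU, hT⟩ := hK U hUcard
  refine ⟨T, hTU.trans (hUA.trans (Finset.filter_subset _ _)), hT, fun i => ?_⟩
  obtain ⟨x, y, z, -, -, -, rfl⟩ := Finset.card_eq_three.1 hT.card_eq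
  have h1 := hUT x (hTU (by simp)) y (hTU (by simp)) z (hTU (by simp))
  replace h1 := h1.trans_eq
    (hcount (fun _ v => ∀ u ∈ ({x, y, z} : Finset (Fin n)), G.Adj u v) (by simp [forall_and]))
  rw [hPcard] at h1
  have proj (C : Fin 3 → ℝ) (hC : ∀ j, 0 ≤ C j) (hCB : ∀ j, C j ≤ (B j).card)
      (h : ρ * ∏ j, ((B j).card : ℝ) ≤ ∏ j, C j) : ρ * (B i).card ≤ C i := by
    rw [← Finset.mul_prod_erase _ _ (Finset.mem_univ i),
      ← Finset.mul_prod_erase _ C (Finset.mem_univ i)] at h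
    refine le_of_mul_le_mul_right ?_
      (Finset.prod_pos (s := Finset.univ.erase i) fun j _ => hBpos j)
    calc _ = ρ * ((B i).card * ∏ j ∈ Finset.univ.erase i, ((B j).card : ℝ)) := by ring
      _ ≤ C i * ∏ j ∈ Finset.univ.erase i, C j := h
      _ ≤ _ := by
        gcongr
        · exact hC i
        · exact fun j _ => hC j
        · exact hCB _
  exact proj
    (fun j => ((B j).filter fun v => ∀ u ∈ ({x, y, z} : Finset (Fin n)), G.Adj u v).card)
    (fun _ => Nat.cast_nonneg _) (fun j => Nat.cast_le.2 (Finset.card_filter_le _ _))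
    (by convert h1)

end Embedding

/-! ### Forbidden configurations of clusters -/

section ReducedGraph

open SimpleGraph

open Classical in
theorem IsDense.of_isUniform {V : Type*} {G : SimpleGraph V} {A B : Finset V} {ε d m : ℝ}
    (h : G.IsUniform ε A B) (hA : A.card * ε ≤ m) (hB : B.card * ε ≤ m)
    (hd : d + ε ≤ G.edgeDensity A B) : IsDense G m d A B := by
  intro A' hA' B' hB' hmA hmB
  have h1 := (abs_lt.1 (h hA' hB' (hA.trans hmA) (hB.trans hmB))).1
  have h2 : d ≤ (G.edgeDensity A' B' : ℝ) := by linarith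
  rw [edgeDensity_def] at h2
  push_cast at h2
  rcases (by positivity : (0 : ℝ) ≤ A'.card * B'.card).eq_or_lt with h0 | h0
  · rw [← h0, mul_zero]; positivity
  · rwa [le_div_iff₀ h0] at h2

open Classical in
/-- Four pairwise densely joined sets span a `K₁₄`. -/
theorem exists_isNClique_of_four_dense {d : ℝ} (hd : 0 < d) (hd1 : d < 1) :
    ∃ κ : ℝ, 0 < κ ∧ ∀ c : ℝ, 0 < c → ∀ᶠ n : ℕ in atTop, ∀ G : SimpleGraph (Fin n),
      (∀ S : Finset (Fin n), (n : ℝ) ^ (19 / 20 : ℝ) ≤ S.card → ∃ T ⊆ S, G.IsNClique 3 T) →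
      ∀ (A B C D : Finset (Fin n)) (L m : ℝ), 0 < m → c * n ≤ L → 6 * m ≤ κ * L →
        (∀ S : Finset (Fin n), κ * L ≤ S.card → ∃ T ⊆ S, G.IsNClique 5 T) →
        L ≤ A.card → L ≤ B.card → L ≤ C.card → L ≤ D.card →
        IsDense G m d A B → IsDense G m d A C → IsDense G m d A D → IsDense G m d B C →
        IsDense G m d B D → IsDense G m d C D → ∃ T, G.IsNClique 14 T := by
  obtain ⟨ρ, hρ, hρ1, H⟩ := exists_triangle_common_neighbors hd hd1
  refine ⟨ρ ^ 3, by positivity, fun c hc => ?_⟩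
  filter_upwards [H c hc, H (ρ * c) (by positivity), H (ρ * (ρ * c)) (by positivity)]
    with n H1 H2 H3
  intro G hK3 A B C D L m hm hL hmL hK5 hA hB hC hD hAB hAC hAD hBC hBD hCD
  have hL0 : 0 < L := by
    by_contra! h
    nlinarith [pow_pos hρ 3]
  have hρ2 : ρ * (ρ * L) ≤ ρ * L := by nlinarith [mul_pos hρ hL0]
  have hρ1' : ρ * L ≤ L := by nlinarith
  have hρ3 : ρ ^ 3 * L = ρ * (ρ * (ρ * L)) := by ring
  have hρ4 : ρ * (ρ * (ρ * L)) ≤ ρ * (ρ * L) := by gcongr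
  have hcL : ρ * c * n ≤ ρ * L := by rw [mul_assoc]; gcongr
  have hcL' : ρ * (ρ * c) * n ≤ ρ * (ρ * L) := by rw [mul_assoc]; gcongr
  obtain ⟨T₁, hT₁A, hT₁, hN₁⟩ := H1 G hK3 A ![B, C, D] m hm (hL.trans hA) (by linarith)
    (by simp only [Fin.forall_fin_succ]; simp; refine ⟨?_, ?_, ?_⟩ <;> linarith)
    (by simp only [Fin.forall_fin_succ]; simp [*])
  simp only [Fin.forall_fin_succ] at hN₁
  simp only [Matrix.cons_val_zero, Matrix.cons_val_succ, IsEmpty.forall_iff, and_true] at hN₁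
  obtain ⟨hB₁, hC₁, hD₁⟩ := hN₁
  set B₁ := B.filter fun v => ∀ x ∈ T₁, G.Adj x v
  set C₁ := C.filter fun v => ∀ x ∈ T₁, G.Adj x v
  set D₁ := D.filter fun v => ∀ x ∈ T₁, G.Adj x v
  have sB₁ : B₁ ⊆ B := Finset.filter_subset _ _
  have sC₁ : C₁ ⊆ C := Finset.filter_subset _ _
  have sD₁ : D₁ ⊆ D := Finset.filter_subset _ _
  have hB₁ : ρ * L ≤ B₁.card := le_trans (by gcongr) hB₁
  have hC₁ : ρ * L ≤ C₁.card := le_trans (by gcongr) hC₁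
  have hD₁ : ρ * L ≤ D₁.card := le_trans (by gcongr) hD₁
  have hBC₁ := hBC.mono sB₁ sC₁
  have hBD₁ := hBD.mono sB₁ sD₁
  -- Only two targets remain; repeating `D₁` fills the third slot.
  obtain ⟨T₂, hT₂B, hT₂, hN₂⟩ := H2 G hK3 B₁ ![C₁, D₁, D₁] m hm (hcL.trans hB₁) (by linarith)
    (by simp only [Fin.forall_fin_succ]; simp; refine ⟨?_, ?_⟩ <;> linarith)
    (by simp only [Fin.forall_fin_succ]; simp [*])
  simp only [Fin.forall_fin_succ] at hN₂
  simp only [Matrix.cons_val_zero, Matrix.cons_val_succ, IsEmpty.forall_iff, and_true] at hN₂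
  obtain ⟨hC₂, hD₂, -⟩ := hN₂
  set C₂ := C₁.filter fun v => ∀ x ∈ T₂, G.Adj x v
  set D₂ := D₁.filter fun v => ∀ x ∈ T₂, G.Adj x v
  have sC₂ : C₂ ⊆ C₁ := Finset.filter_subset _ _
  have sD₂ : D₂ ⊆ D₁ := Finset.filter_subset _ _
  have hC₂ : ρ * (ρ * L) ≤ C₂.card := le_trans (by gcongr) hC₂
  have hD₂ : ρ * (ρ * L) ≤ D₂.card := le_trans (by gcongr) hD₂
  have hCD₂ := hCD.mono (sC₂.trans sC₁) (sD₂.trans sD₁)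
  obtain ⟨T₃, hT₃C, hT₃, hN₃⟩ := H3 G hK3 C₂ (fun _ => D₂) m hm (hcL'.trans hC₂)
    (by linarith) (fun _ => by linarith) (fun _ => hCD₂)
  obtain ⟨T₄, hT₄D, hT₄⟩ := hK5 (D₂.filter fun v => ∀ x ∈ T₃, G.Adj x v)
    (hρ3.trans_le (le_trans (by gcongr) (hN₃ 0)))
  have sT₄ : T₄ ⊆ D₂ := hT₄D.trans (Finset.filter_subset _ _)
  have adj₁ : ∀ x ∈ T₁, ∀ y ∈ T₂ ∪ (T₃ ∪ T₄), G.Adj x y := by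
    intro x hx y hy
    rcases Finset.mem_union.1 hy with hy | hy
    · exact (Finset.mem_filter.1 (hT₂B hy)).2 x hx
    rcases Finset.mem_union.1 hy with hy | hy
    · exact (Finset.mem_filter.1 (sC₂ (hT₃C hy))).2 x hx
    · exact (Finset.mem_filter.1 (sD₂ (sT₄ hy))).2 x hx
  have adj₂ : ∀ x ∈ T₂, ∀ y ∈ T₃ ∪ T₄, G.Adj x y := by
    intro x hx y hy
    rcases Finset.mem_union.1 hy with hy | hy
    · exact (Finset.mem_filter.1 (hT₃C hy)).2 x hx
    · exact (Finset.mem_filter.1 (sT₄ hy)).2 x hx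
  have adj₃ : ∀ x ∈ T₃, ∀ y ∈ T₄, G.Adj x y :=
    fun x hx y hy => (Finset.mem_filter.1 (hT₄D hy)).2 x hx
  exact ⟨_, isNClique_union hT₁ (isNClique_union hT₂ (isNClique_union hT₃ hT₄ adj₃) adj₂) adj₁⟩

open Classical in
/-- Three pairwise densely joined sets, two of them with density above `4 / 5`, span a `K₁₃`. -/
theorem exists_isNClique_of_three_dense {d η : ℝ} (hd : 0 < d) (hd1 : d < 1) (hη : 0 < η) :
    ∃ κ : ℝ, 0 < κ ∧ ∀ c : ℝ, 0 < c → ∀ᶠ n : ℕ in atTop, ∀ G : SimpleGraph (Fin n),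
      (∀ S : Finset (Fin n), (n : ℝ) ^ (19 / 20 : ℝ) ≤ S.card → ∃ T ⊆ S, G.IsNClique 3 T) →
      ∀ (A B C : Finset (Fin n)) (L m : ℝ), 0 < m → c * n ≤ L → 6 * m ≤ κ * L →
        (∀ S : Finset (Fin n), κ * L ≤ S.card → ∃ T ⊆ S, G.IsNClique 5 T) →
        L ≤ A.card → L ≤ B.card → L ≤ C.card →
        IsDense G m (4 / 5 + η) A B → IsDense G m d C A → IsDense G m d C B →
        ∃ T, G.IsNClique 13 T := by
  obtain ⟨ρ, hρ, hρ1, H⟩ := exists_triangle_common_neighbors hd hd1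
  have hmin : 0 < min (1 / 2) (5 * η) := by positivity
  -- The 1/2 leaves room in `A₁` for m low-degree vertices; 5η = 5(4/5+η) - 4 is the share of `B₁`
  -- joined to a whole K₅.
  refine ⟨min (1 / 2) (5 * η) * ρ, by positivity, fun c hc => ?_⟩
  filter_upwards [H c hc] with n H1
  intro G hK3 A B C L m hm hL hmL hK5 hA hB hC hAB hCA hCB
  have hL0 : 0 < L := by
    by_contra! h
    nlinarith [mul_pos hmin hρ]
  have hρL : 0 < ρ * L := by positivity
  have hρ1' : ρ * L ≤ L := by nlinarith
  rw [mul_assoc] at hmL hK5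
  have hκ1 : min (1 / 2) (5 * η) * (ρ * L) ≤ 1 / 2 * (ρ * L) := by gcongr; exact min_le_left _ _
  have hκ2 : min (1 / 2) (5 * η) * (ρ * L) ≤ 5 * η * (ρ * L) := by gcongr; exact min_le_right _ _
  obtain ⟨T₁, hT₁C, hT₁, hN₁⟩ := H1 G hK3 C ![A, B, B] m hm (hL.trans hC) (by linarith)
    (by simp only [Fin.forall_fin_succ]; simp; refine ⟨?_, ?_⟩ <;> linarith)
    (by simp only [Fin.forall_fin_succ]; simp [*])
  simp only [Fin.forall_fin_succ] at hN₁
  simp only [Matrix.cons_val_zero, Matrix.cons_val_succ, IsEmpty.forall_iff, and_true] at hN₁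
  obtain ⟨hA₁, hB₁, -⟩ := hN₁
  set A₁ := A.filter fun v => ∀ x ∈ T₁, G.Adj x v
  set B₁ := B.filter fun v => ∀ x ∈ T₁, G.Adj x v
  have hA₁ : ρ * L ≤ A₁.card := le_trans (by gcongr) hA₁
  have hB₁ : ρ * L ≤ B₁.card := le_trans (by gcongr) hB₁
  obtain ⟨T₂, hT₂, hT₂'⟩ := (hAB.mono (Finset.filter_subset _ _ : A₁ ⊆ A)
    (Finset.filter_subset _ _ : B₁ ⊆ B)).exists_isNClique_ten hm (by linarith) (by linarith)
    (hκ2.trans (by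
      rw [show 5 * (4 / 5 + η) - 4 = 5 * η by ring]
      gcongr)) hK5
  refine ⟨_, isNClique_union hT₁ hT₂' fun x hx y hy => ?_⟩
  rcases hT₂ y hy with hy | hy
  · exact (Finset.mem_filter.1 hy).2 x hx
  · exact (Finset.mem_filter.1 hy).2 x hx

end ReducedGraph

/-! ### Counting edges through the reduced graph -/

section EdgeCount

open SimpleGraph

open Classical in
/-- Adjacency in the reduced graph of a regular partition. -/
def IsReducedEdge {V : Type*} (G : SimpleGraph V) (ε d : ℝ) (A B : Finset V) : Prop :=
  A ≠ B ∧ G.IsUniform ε A B ∧ d ≤ G.edgeDensity A B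

open Classical in
theorem two_mul_ncard_edgeSet_eq_sum {V : Type*} [Fintype V] [DecidableEq V] (G : SimpleGraph V)
    (P : Finpartition (Finset.univ : Finset V)) :
    2 * G.edgeSet.ncard = ∑ A ∈ P.parts, ∑ B ∈ P.parts, (G.interedges A B).card := by
  rw [← Finset.sum_product', ← coe_edgeFinset, Set.ncard_coe_finset, two_mul_card_edgeFinset]
  refine Eq.trans ?_ (Rel.card_interedges_finpartition G.Adj P P)
  congr 1

open Classical in
theorem two_mul_ncard_edgeSet_le {n : ℕ} (G : SimpleGraph (Fin n))
    (P : Finpartition (Finset.univ : Finset (Fin n))) (hP : P.IsEquipartition) {ε d β : ℝ}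
    (hU : P.IsUniform G ε) (hε : 0 ≤ ε) (hd : 0 ≤ d) (hβ : 3 / 4 ≤ β)
    (h3 : ∀ A ∈ P.parts, ∀ B ∈ P.parts, ∀ C ∈ P.parts, IsReducedEdge G ε d A B →
      IsReducedEdge G ε d B C → IsReducedEdge G ε d A C → (G.edgeDensity A B : ℝ) ≤ β)
    (h4 : ∀ A ∈ P.parts, ∀ B ∈ P.parts, ∀ C ∈ P.parts, ∀ D ∈ P.parts, IsReducedEdge G ε d A B →
      IsReducedEdge G ε d A C → IsReducedEdge G ε d A D → IsReducedEdge G ε d B C →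
      IsReducedEdge G ε d B D → IsReducedEdge G ε d C D → False) :
    2 * (G.edgeSet.ncard : ℝ) ≤ ((n / P.parts.card + 1 : ℕ) : ℝ) ^ 2 *
      (P.parts.card + (ε + d + 2 / 3 * β) * (P.parts.card : ℝ) ^ 2) := by
  set k := P.parts.card with hk
  set x : ℝ := ((n / k + 1 : ℕ) : ℝ) with hx
  let w (A B : Finset (Fin n)) : ℝ :=
    if IsReducedEdge G ε d A B then (G.edgeDensity A B : ℝ) else 0
  have hdens0 (A B : Finset (Fin n)) : (0 : ℝ) ≤ G.edgeDensity A B := by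
    exact_mod_cast G.edgeDensity_nonneg A B
  have hdens1 (A B : Finset (Fin n)) : (G.edgeDensity A B : ℝ) ≤ 1 := by
    exact_mod_cast G.edgeDensity_le_one A B
  have hcard (A : Finset (Fin n)) (hA : A ∈ P.parts) : (A.card : ℝ) ≤ x := by
    have := hP.card_part_le_average_add_one hA
    rw [Finset.card_univ, Fintype.card_fin] at this
    rw [hx]
    exact_mod_cast this
  have hinter (A B : Finset (Fin n)) :
      ((G.interedges A B).card : ℝ) = G.edgeDensity A B * (A.card * B.card) := by
    rw [edgeDensity_def]
    push_cast
    rcases (by positivity : (0 : ℝ) ≤ A.card * B.card).eq_or_lt with h0 | h0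
    · have := G.card_interedges_le_mul A B
      have : ((G.interedges A B).card : ℝ) ≤ A.card * B.card := by exact_mod_cast this
      rw [← h0, mul_zero]
      exact le_antisymm (this.trans h0.ge) (by positivity)
    · rw [div_mul_cancel₀ _ h0.ne']
  -- Pairs inside a cluster, irregular pairs and sparse pairs are each charged to their own error
  -- term; the rest is the Turán weight.
  have hterm : ∀ A ∈ P.parts, ∀ B ∈ P.parts, ((G.interedges A B).card : ℝ) ≤
      x ^ 2 * ((if A = B then 1 else 0) + (if (A, B) ∈ P.nonUniforms G ε then 1 else 0)
        + d + w A B) := by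
    intro A hA B hB
    rw [hinter, mul_comm]
    have hAB : (A.card : ℝ) * B.card ≤ x ^ 2 := by
      rw [sq]
      exact mul_le_mul (hcard A hA) (hcard B hB) (by positivity) (by positivity)
    refine mul_le_mul hAB ?_ (hdens0 A B) (by positivity)
    have hw : 0 ≤ w A B := by
      simp only [w]; split_ifs; exacts [hdens0 A B, le_rfl]
    by_cases hne : A = B
    · rw [if_pos hne]
      have : (0 : ℝ) ≤ if (A, B) ∈ P.nonUniforms G ε then 1 else 0 := by positivity
      linarith [hdens1 A B]
    by_cases hunif : G.IsUniform ε A B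
    · rw [if_neg hne, if_neg (by simp [hunif])]
      by_cases hlow : d ≤ G.edgeDensity A B
      · have : w A B = G.edgeDensity A B := if_pos ⟨hne, hunif, hlow⟩
        linarith
      · linarith
    · rw [if_neg hne, if_pos (by simp [hA, hB, hne, hunif])]
      linarith [hdens1 A B]
  have hw_pos {A B : Finset (Fin n)} (h : 0 < w A B) : IsReducedEdge G ε d A B := by
    by_contra hn
    simp [w, hn] at h
  have hw_symm (A B : Finset (Fin n)) : w A B = w B A := by
    have : IsReducedEdge G ε d A B ↔ IsReducedEdge G ε d B A := by
      rw [IsReducedEdge, IsReducedEdge, ne_comm, isUniform_comm, edgeDensity_comm]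
    simp only [w, this, G.edgeDensity_comm A B]
  have hturan := sum_sum_le_of_no_four_clique (w := w) hβ hw_symm
    (fun A B => by simp only [w]; split_ifs; exacts [hdens0 A B, le_rfl])
    (fun A B => by simp only [w]; split_ifs; exacts [hdens1 A B, zero_le_one])
    (fun A => if_neg fun h => h.1 rfl) P.parts
    (fun A hA B hB C hC hAB hBC hAC => by
      have := h3 A hA B hB C hC (hw_pos hAB) (hw_pos hBC) (hw_pos hAC)
      simpa only [w, if_pos (hw_pos hAB)] using this)
    (fun A hA B hB C hC D hD h₁ h₂ h₃ h₄ h₅ h₆ => h4 A hA B hB C hC D hD (hw_pos h₁) (hw_pos h₂)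
      (hw_pos h₃) (hw_pos h₄) (hw_pos h₅) (hw_pos h₆))
  have hdiag : ∑ A ∈ P.parts, ∑ B ∈ P.parts, (if A = B then (1 : ℝ) else 0) = k := by
    rw [Finset.sum_congr rfl fun A hA => by rw [Finset.sum_ite_eq, if_pos hA]]
    simp [hk]
  have hnon : ∑ A ∈ P.parts, ∑ B ∈ P.parts,
      (if (A, B) ∈ P.nonUniforms G ε then (1 : ℝ) else 0) ≤ ε * (k : ℝ) ^ 2 := by
    rw [← Finset.sum_product' (f := fun A B => if (A, B) ∈ P.nonUniforms G ε then (1 : ℝ) else 0),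
      Finset.sum_boole]
    have h1 : (((P.parts ×ˢ P.parts).filter fun p => (p.1, p.2) ∈ P.nonUniforms G ε).card : ℝ)
        ≤ (P.nonUniforms G ε).card := by
      refine Nat.cast_le.2 (Finset.card_le_card fun p hp => (Finset.mem_filter.1 hp).2)
    refine h1.trans (hU.trans ?_)
    rw [mul_comm]
    gcongr
    rw [sq]
    exact_mod_cast Nat.mul_le_mul_left _ (Nat.sub_le _ _)
  calc 2 * (G.edgeSet.ncard : ℝ)
      = ∑ A ∈ P.parts, ∑ B ∈ P.parts, ((G.interedges A B).card : ℝ) := by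
        exact_mod_cast two_mul_ncard_edgeSet_eq_sum G P
    _ ≤ ∑ A ∈ P.parts, ∑ B ∈ P.parts, x ^ 2 * ((if A = B then 1 else 0)
        + (if (A, B) ∈ P.nonUniforms G ε then 1 else 0) + d + w A B) :=
      Finset.sum_le_sum fun A hA => Finset.sum_le_sum fun B hB => hterm A hA B hB
    _ = x ^ 2 * (∑ A ∈ P.parts, ∑ B ∈ P.parts, (if A = B then (1 : ℝ) else 0)
        + ∑ A ∈ P.parts, ∑ B ∈ P.parts, (if (A, B) ∈ P.nonUniforms G ε then (1 : ℝ) else 0)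
        + d * (k : ℝ) ^ 2 + ∑ A ∈ P.parts, ∑ B ∈ P.parts, w A B) := by
      simp_rw [← Finset.mul_sum, Finset.sum_add_distrib]
      simp only [Finset.sum_const, nsmul_eq_mul]
      ring
    _ ≤ x ^ 2 * (k + ε * (k : ℝ) ^ 2 + d * (k : ℝ) ^ 2 + 2 / 3 * β * (k : ℝ) ^ 2) := by
      rw [hdiag]
      gcongr
    _ = _ := by ring

end EdgeCount

/-! ### Choice of parameters and passage to the limit -/

section Main

open SimpleGraph

theorem eventually_rpow_mul_add_one_lt :
    ∀ᶠ x : ℝ in atTop,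
      x ^ (9 / 20 : ℝ) * (x ^ (9 / 20 : ℝ) + 1) < x ^ (19 / 20 : ℝ) := by
  have ho : (fun x : ℝ => 2 * x ^ (9 / 10 : ℝ)) =o[atTop] fun x : ℝ => x ^ (19 / 20 : ℝ) :=
    (isLittleO_rpow_rpow_atTop (by norm_num)).const_mul_left 2
  filter_upwards [ho.bound (show (0 : ℝ) < 1 / 2 by norm_num), eventually_ge_atTop 1] with x hx hx1
  have hx0 : 0 < x := by linarith
  rw [Real.norm_of_nonneg (by positivity), Real.norm_of_nonneg (by positivity)] at hx
  have h1 : x ^ (9 / 20 : ℝ) * x ^ (9 / 20 : ℝ) = x ^ (9 / 10 : ℝ) := by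
    rw [← Real.rpow_add hx0]; norm_num
  have h2 : x ^ (9 / 20 : ℝ) ≤ x ^ (9 / 10 : ℝ) :=
    Real.rpow_le_rpow_of_exponent_le hx1 (by norm_num)
  have h3 : 0 < x ^ (19 / 20 : ℝ) := by positivity
  rw [mul_add, h1, mul_one]
  linarith

theorem sq_mul_add_le {τ η ε k x n : ℝ} (hτ : 0 ≤ τ) (hτη : 40 * τ ≤ η) (hτ1 : 40 * τ ≤ 1)
    (hετ : ε ≤ τ) (hk : k ≤ τ * k ^ 2) (hk0 : 0 ≤ k) (hx0 : 0 ≤ x) (hx : x * k ≤ (1 + τ) * n) :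
    x ^ 2 * (k + (ε + 2 * τ + 2 / 3 * (4 / 5 + 2 * τ)) * k ^ 2) ≤ (8 / 15 + η) * n ^ 2 := by
  have h5 : (1 + τ) ^ 2 ≤ 1 + 3 * τ := by nlinarith
  have h6 : (1 + 3 * τ) * (8 / 15 + 16 / 3 * τ) ≤ 8 / 15 + η := by nlinarith
  calc x ^ 2 * (k + (ε + 2 * τ + 2 / 3 * (4 / 5 + 2 * τ)) * k ^ 2)
      ≤ x ^ 2 * (τ * k ^ 2 + (τ + 2 * τ + 2 / 3 * (4 / 5 + 2 * τ)) * k ^ 2) := by gcongr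
    _ = (x * k) ^ 2 * (8 / 15 + 16 / 3 * τ) := by ring
    _ ≤ ((1 + τ) * n) ^ 2 * (8 / 15 + 16 / 3 * τ) := by gcongr
    _ = ((1 + τ) ^ 2 * (8 / 15 + 16 / 3 * τ)) * n ^ 2 := by ring
    _ ≤ ((1 + 3 * τ) * (8 / 15 + 16 / 3 * τ)) * n ^ 2 := by gcongr
    _ ≤ (8 / 15 + η) * n ^ 2 := by gcongr

open Classical in
theorem eventually_ncard_edgeSet_le {η : ℝ} (hη : 0 < η) :
    ∃ δ : ℝ, 0 < δ ∧ ∀ᶠ n : ℕ in atTop, ∀ G : SimpleGraph (Fin n), G.CliqueFree 13 →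
      (G.indepNum : ℝ) ≤ δ * inverseRamsey 5 n →
      2 * (G.edgeSet.ncard : ℝ) ≤ (8 / 15 + η) * (n : ℝ) ^ 2 := by
  obtain ⟨τ, hτ, hτη, hτ1⟩ : ∃ τ : ℝ, 0 < τ ∧ 40 * τ ≤ η ∧ 40 * τ ≤ 1 :=
    ⟨min η 1 / 40, by positivity, by linarith [min_le_left η 1], by linarith [min_le_right η 1]⟩
  obtain ⟨κ₃, hκ₃, H₃⟩ := exists_isNClique_of_three_dense hτ (by linarith) hτ
  obtain ⟨κ₄, hκ₄, H₄⟩ := exists_isNClique_of_four_dense hτ (by linarith)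
  set κ := min κ₃ κ₄ with hκdef
  have hκ : 0 < κ := by positivity
  -- Clusters have at most L + 1 ≤ 2L vertices, so m = 2Lε works for regularity, and 12ε ≤ κ gives
  -- 6m ≤ κL. Also l ≥ 1/τ makes the diagonal term k at most τk², and c = 1/(2M) gives L ≥ cn.
  set ε := min τ (κ / 12) with hεdef
  have hε : 0 < ε := by positivity
  have hετ : ε ≤ τ := min_le_left _ _
  have hεκ : 12 * ε ≤ κ := by linarith [min_le_right τ (κ / 12)]
  set l := ⌈1 / τ⌉₊ with hl
  set M := SzemerediRegularity.bound ε l with hM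
  have hM0 : (0 : ℝ) < M := by exact_mod_cast SzemerediRegularity.bound_pos ε l
  set c : ℝ := 1 / (2 * M) with hc
  have hc0 : 0 < c := by positivity
  have hκc : 0 < κ * c := by positivity
  refine ⟨min 1 (1 / (2 * (1 / (κ * c) + 1))), by positivity, ?_⟩
  filter_upwards [H₃ c hc0, H₄ c hc0, eventually_inverseRamsey_five_le, eventually_ge_atTop l,
    eventually_ge_atTop M, eventually_ge_atTop ⌈M / τ⌉₊, eventually_gt_atTop 0,
    tendsto_natCast_atTop_atTop.eventually eventually_rpow_mul_add_one_lt]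
    with n H₃ H₄ hQ hnl hnM hnMτ hn hnlarge
  intro G hG hα
  set δ := min 1 (1 / (2 * (1 / (κ * c) + 1))) with hδ
  have hδ0 : 0 < δ := by positivity
  have hnr : (0 : ℝ) < n := by exact_mod_cast hn
  have hK5 : ∀ S : Finset (Fin n), κ * c * n ≤ S.card → ∃ T ⊆ S, G.IsNClique 5 T := by
    intro S hS
    refine exists_isNClique_of_indepNum_le (by norm_num) hκc hδ0 ?_ G hα S hn hS
    have hpos : 0 < 1 / (κ * c) + 1 := by positivity
    calc δ * (1 / (κ * c) + 1) ≤ 1 / (2 * (1 / (κ * c) + 1)) * (1 / (κ * c) + 1) := by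
          gcongr; exact min_le_right _ _
      _ = 1 / 2 := by field_simp
      _ < 1 := by norm_num
  have hK3 : ∀ S : Finset (Fin n), (n : ℝ) ^ (19 / 20 : ℝ) ≤ S.card →
      ∃ T ⊆ S, G.IsNClique 3 T := by
    intro S hS
    by_contra! hfree
    have h1 := card_le_of_forall_not_isNClique_three G S hfree
    have h1 : (S.card : ℝ) ≤ G.indepNum * (G.indepNum + 1) := by exact_mod_cast h1
    have h2 : (G.indepNum : ℝ) ≤ (n : ℝ) ^ (9 / 20 : ℝ) := by
      refine hα.trans (le_trans ?_ hQ)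
      exact mul_le_of_le_one_left (by positivity) (min_le_left _ _)
    have h3 : (G.indepNum : ℝ) * (G.indepNum + 1)
        ≤ (n : ℝ) ^ (9 / 20 : ℝ) * ((n : ℝ) ^ (9 / 20 : ℝ) + 1) := by gcongr
    linarith
  obtain ⟨P, hP, hPl, hPM, hPU⟩ := szemeredi_regularity G hε
    (show l ≤ Fintype.card (Fin n) by rwa [Fintype.card_fin])
  set k := P.parts.card with hk
  have hkτ : 1 / τ ≤ k := (Nat.le_ceil _).trans (by exact_mod_cast hPl)
  have hk0 : (0 : ℝ) < k := lt_of_lt_of_le (by positivity) hkτ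
  have hk0' : 0 < k := by exact_mod_cast hk0
  have hkM : (k : ℝ) ≤ M := by exact_mod_cast hPM
  set L : ℕ := n / k with hL
  have hL1 : 1 ≤ L := (Nat.one_le_div_iff hk0').2 (hPM.trans hnM)
  have hL1r : (1 : ℝ) ≤ L := by exact_mod_cast hL1
  have hcL : c * n ≤ L := by
    have h1 : n < (L + 1) * k := by
      rw [mul_comm]; exact Nat.lt_mul_div_succ n hk0'
    have h1 : (n : ℝ) < (L + 1) * k := by exact_mod_cast h1
    rw [hc, one_div, inv_mul_le_iff₀ (by positivity)]
    nlinarith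
  have hpart : ∀ A ∈ P.parts, (L : ℝ) ≤ A.card := by
    intro A hA
    have := hP.average_le_card_part hA
    rw [Finset.card_univ, Fintype.card_fin] at this
    exact_mod_cast this
  have hpart' : ∀ A ∈ P.parts, (A.card : ℝ) * ε ≤ 2 * L * ε := by
    intro A hA
    have := hP.card_part_le_average_add_one hA
    rw [Finset.card_univ, Fintype.card_fin] at this
    have : (A.card : ℝ) ≤ L + 1 := by exact_mod_cast this
    gcongr
    linarith
  have hm : 0 < 2 * L * ε := by positivity
  have hm6 : 6 * (2 * L * ε) ≤ κ * L := by nlinarith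
  have hK5' : ∀ κ', κ ≤ κ' → ∀ S : Finset (Fin n), κ' * L ≤ S.card →
      ∃ T ⊆ S, G.IsNClique 5 T := by
    intro κ' hκ' S hS
    refine hK5 S (le_trans ?_ hS)
    rw [mul_assoc]
    exact mul_le_mul hκ' hcL (by positivity) (hκ.le.trans hκ')
  have hdense {A B : Finset (Fin n)} (hA : A ∈ P.parts) (hB : B ∈ P.parts)
      (h : IsReducedEdge G ε (2 * τ) A B) : IsDense G (2 * L * ε) τ A B :=
    .of_isUniform h.2.1 (hpart' A hA) (hpart' B hB) (by linarith [h.2.2])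
  have hsymm {A B : Finset (Fin n)} (h : IsReducedEdge G ε (2 * τ) A B) :
      IsReducedEdge G ε (2 * τ) B A :=
    ⟨h.1.symm, h.2.1.symm, by rw [edgeDensity_comm]; exact h.2.2⟩
  -- Regularity costs ε ≤ τ in density, so the thresholds 2τ and 4/5 + 2τ leave τ and 4/5 + τ for
  -- the embeddings.
  have key := two_mul_ncard_edgeSet_le G P hP (d := 2 * τ) (β := 4 / 5 + 2 * τ) hPU hε.le
    (by linarith) (by linarith) ?_ ?_
  · refine key.trans ?_
    have h1 : (k : ℝ) ≤ τ * (k : ℝ) ^ 2 := by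
      rw [div_le_iff₀ hτ] at hkτ
      nlinarith
    have h2 : ((L + 1 : ℕ) : ℝ) * k ≤ (1 + τ) * n := by
      have h3 : (L : ℝ) * k ≤ n := by exact_mod_cast Nat.div_mul_le_self n k
      have h4 : (M : ℝ) / τ ≤ n := (Nat.le_ceil _).trans (by exact_mod_cast hnMτ)
      rw [div_le_iff₀ hτ] at h4
      push_cast
      linarith
    exact sq_mul_add_le hτ.le hτη hτ1 hετ h1 (by positivity) (by positivity) h2
  · intro A hA B hB C hC hAB hBC hAC
    by_contra! hlt
    obtain ⟨T, hT⟩ := H₃ G hK3 A B C L (2 * L * ε) hm hcL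
      (hm6.trans (by gcongr; exact min_le_left _ _)) (hK5' κ₃ (min_le_left _ _))
      (hpart A hA) (hpart B hB) (hpart C hC)
      (.of_isUniform hAB.2.1 (hpart' A hA) (hpart' B hB) (by linarith))
      (hdense hC hA (hsymm hAC)) (hdense hC hB (hsymm hBC))
    exact hG T hT
  · intro A hA B hB C hC D hD hAB hAC hAD hBC hBD hCD
    obtain ⟨T, hT⟩ := H₄ G hK3 A B C D L (2 * L * ε) hm hcL
      (hm6.trans (by gcongr; exact min_le_right _ _)) (hK5' κ₄ (min_le_right _ _))
      (hpart A hA) (hpart B hB) (hpart C hC) (hpart D hD) (hdense hA hB hAB) (hdense hA hC hAC)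
      (hdense hA hD hAD) (hdense hB hC hBC) (hdense hB hD hBD) (hdense hC hD hCD)
    exact (hG.mono (by norm_num : 13 ≤ 14)) T hT

theorem RT_mono {W : Type*} (n : ℕ) (H : SimpleGraph W) {x y : ℝ} (h : x ≤ y) :
    RT n H x ≤ RT n H y := by
  have hsub : edgeCounts H n x ⊆ edgeCounts H n y := by
    rintro e ⟨G, hG, hGx, hGe⟩
    exact ⟨G, hG, hGx.trans h, hGe⟩
  rcases (edgeCounts H n x).eq_empty_or_nonempty with h0 | h0
  · simp [RT, h0]
  · exact csSup_le_csSup (bddAbove_edgeCounts H n y) h0 hsub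

theorem isBoundedUnder_le_RT {W : Type*} (H : SimpleGraph W) (f : ℕ → ℝ) :
    IsBoundedUnder (· ≤ ·) atTop fun n : ℕ => (RT n H (f n) : ℝ) / (n : ℝ) ^ 2 :=
  isBoundedUnder_of ⟨1, fun n => (RT_div_mem_Icc n H (f n)).2⟩

theorem isCoboundedUnder_le_RT {W : Type*} (H : SimpleGraph W) (f : ℕ → ℝ) :
    IsCoboundedUnder (· ≤ ·) atTop fun n : ℕ => (RT n H (f n) : ℝ) / (n : ℝ) ^ 2 :=
  (isBoundedUnder_of ⟨0, fun n => (RT_div_mem_Icc n H (f n)).1⟩ :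
    IsBoundedUnder (· ≥ ·) atTop _).isCoboundedUnder_le

theorem upperDensity_nonneg {W : Type*} (H : SimpleGraph W) (f : ℕ → ℝ) :
    0 ≤ upperDensity H f :=
  le_limsup_of_frequently_le
    (Frequently.of_forall fun n => (RT_div_mem_Icc n H (f n)).1) (isBoundedUnder_le_RT H f)

theorem upperDensity_mono {W : Type*} (H : SimpleGraph W) {f g : ℕ → ℝ} (h : ∀ n, f n ≤ g n) :
    upperDensity H f ≤ upperDensity H g := by
  refine limsup_le_limsup (Eventually.of_forall fun n => ?_) (isCoboundedUnder_le_RT H f)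
    (isBoundedUnder_le_RT H g)
  dsimp only
  gcongr
  exact RT_mono n H (h n)

theorem exists_upperDensity_le {η : ℝ} (hη : 0 < η) :
    ∃ δ : ℝ, 0 < δ ∧ upperDensity (completeGraph (Fin 13))
      (fun n : ℕ => δ * (inverseRamsey 5 n : ℝ)) ≤ 4 / 15 + η := by
  obtain ⟨δ, hδ, H⟩ := eventually_ncard_edgeSet_le hη
  refine ⟨δ, hδ, limsup_le_of_le (isCoboundedUnder_le_RT _ _) ?_⟩
  filter_upwards [H, eventually_gt_atTop 0] with n hn hn0
  have hn0 : (0 : ℝ) < n := by exact_mod_cast hn0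
  rw [div_le_iff₀ (by positivity)]
  rcases (edgeCounts (completeGraph (Fin 13)) n
    (δ * (inverseRamsey 5 n : ℝ))).eq_empty_or_nonempty with h0 | h0
  -- With no admissible graph, `sSup ∅ = 0` in ℕ.
  · rw [RT, h0]
    simp only [csSup_empty, bot_eq_zero', Nat.cast_zero]
    positivity
  · obtain ⟨G, hG, hα, he⟩ := Nat.sSup_mem h0 (bddAbove_edgeCounts _ _ _)
    have hfree : G.CliqueFree 13 := by
      have := (cliqueFree_iff_top_free (G := G) (β := Fin 13)).2 hG
      rwa [Fintype.card_fin] at this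
    have := hn G hfree hα
    rw [RT, ← he]
    nlinarith [mul_pos hη (pow_pos hn0 2)]

end Main

end RamseyTuran

theorem mainTheorem4 :
    ∃ c : ℝ, c ≤ 4 / 15 ∧
      Tendsto
        (fun δ : ℝ =>
          RamseyTuran.upperDensity (SimpleGraph.completeGraph (Fin 13))
            (fun n : ℕ => δ * (RamseyTuran.inverseRamsey 5 n : ℝ)))
        (𝓝[>] 0) (𝓝 c) := by
  have hmono : Monotone fun δ : ℝ =>
      RamseyTuran.upperDensity (SimpleGraph.completeGraph (Fin 13))
        (fun n : ℕ => δ * (RamseyTuran.inverseRamsey 5 n : ℝ)) :=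
    fun δ δ' h => RamseyTuran.upperDensity_mono _ fun n => by gcongr
  refine ⟨_, le_of_forall_pos_le_add fun η hη => ?_, hmono.tendsto_nhdsGT 0⟩
  obtain ⟨δ, hδ, hle⟩ := RamseyTuran.exists_upperDensity_le hη
  refine le_trans (csInf_le ?_ (Set.mem_image_of_mem _ (Set.mem_Ioi.2 hδ))) hle
  refine ⟨0, ?_⟩
  rintro _ ⟨δ', -, rfl⟩
  exact RamseyTuran.upperDensity_nonneg _ _
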